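/- **Notation.** Let $\mathbb T$ be the unit circle with normalized Lebesgue measure $m$. All Hilbert spaces are complex and separable. For a Hilbert space $E$, $L^2_E$ is the space of square-integrable $E$-valued functions on $\mathbb T$, $\widehat f(n)=\int_{\mathbb T}\bar z^{\,n}f(z)\,dm(z)$, $H^2_E=\{f\in L^2_E:\widehat f(n)=0\ \text{for}\ n<0\}$, $P_+$ is the orthogonal projection of $L^2_E$ onto $H^2_E$, $(S_Ef)(z)=zf(z)$ is the shift on $H^2_E$, and $g(\zeta)=\sum_{n\ge0}\widehat g(n)\zeta^n$ for $g\in H^2_E$, $\zeta\in\mathbb D$. For Hilbert spaces $D,E$, $L^2_s(\mathcal B(D,E))$ (resp. $H^2_s(\mathcal B(D,E))$) is the set of $\mathcal B(D,E)$-valued functions $\Phi$ on $\mathbb T$ with $\Phi(\cdot)x\in L^2_E$ (resp. $H^2_E$) for every $x\in D$; $\Phi^*(z)=\Phi(z)^*$ and $\widetilde\Phi(z)=\Phi(\bar z)^*$. An *inner function with values in* $\mathcal B(D,E)$ is an essentially bounded function $\Delta$ in $H^2_s(\mathcal B(D,E))$ with $\Delta^*\Delta=I_D$ a.e. An inner function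 $\Omega$ with values in $\mathcal B(D',E)$ is a *left inner divisor* of $\Phi\in H^2_s(\mathcal B(D,E))$ if $\Phi=\Omega A$ for some $A\in H^2_s(\mathcal B(D,D'))$. Two functions $\Phi,\Psi$ are *right coprime* if the only common left inner divisors of $\widetilde\Phi$ and $\widetilde\Psi$ are constant unitary operators. For $F\subseteq H^2_E$ let $E_F^*$ be the closed linear span of $\bigcup_{n\ge0}S_E^{*n}F$ and $\operatorname{nc}(F)=\sup_{\zeta\in\mathbb D}\dim\{g(\zeta):g\in H^2_E\ominus E_F^*\}$. For $\Phi\in L^2_s(\mathcal B(D,E))$ and an orthonormal basis $(d_k)$ of $D$, $\{\Phi_+\}$ is the set of the functions $P_+(\Phi(\cdot)d_k)$; the number $\operatorname{nc}\{\Phi_+\}$ does not depend on the basis. **Canonical decompositions and Beurling degree.** Let $\Delta$ be an inner function with values in $\mathcal B(E',E)$. An expression $\Phi=\Delta A^*+B$ (a.e. on $\mathbb T$) is a *canonical decomposition* of $\Phi\in L^2_s(\mathcal B(D,E))$ if $A$ is $\mathcal B(E',D)$-valued with $\widetilde A\in H^2_s(\mathcal B(D,E'))$, $B\in L^2_s(\mathcal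 B(D,E))$, $\Delta$ and $A$ are right coprime, $\Delta^*B=0$ a.e., and $\operatorname{nc}\{\Phi_+\}\le\dim E'$. The *Beurling degree* $\deg_B(\Delta)\in\{1,2,\dots,\infty\}$ is the infimum of $\dim D$ over all separable Hilbert spaces $D\neq\{0\}$ for which there is a pair $(A,B)$ such that $\Phi=\Delta A^*+B$ is a canonical decomposition of some $\Phi\in L^2_s(\mathcal B(D,E))$. The *spectral multiplicity* $\mu_T$ of a bounded operator $T$ on a Hilbert space $\mathcal H$ is the infimum of $\dim F$ over all linear subspaces $F\subseteq\mathcal H$ such that the closed linear span of $\bigcup_{n\ge0}T^nF$ is $\mathcal H$. **Theorem (Beurling degree and spectral multiplicity).** Let $E$ be a separable complex Hilbert space and $\Delta$ an inner function with values in $\mathcal B(E',E)$, where $\dim E'<\infty$. Let $\mathcal H(\Delta)=H^2_E\ominus\Delta H^2_{E'}$ and $T=S_E^*|_{\mathcal H(\Delta)}$. If $\mathcal H(\Delta)\ne\{0\}$, then $$\mu_T=\deg_B(\Delta).$$ If $\mathcal H(\Delta)=\{0\}$, then $\deg_B(\Delta)=1$ (so that the equality persists under the convention that the operator on the zero space is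 counted as multiplicity-free, i.e. as having multiplicity $1$). -/

import Mathlib

open MeasureTheory Filter AddCircle
open scoped InnerProductSpace ENNReal

set_option linter.unusedSectionVars false

noncomputable section

namespace Beurling

/-! The unit circle is parametrized by `UnitAddCircle = ℝ / ℤ` through `t ↦ z = exp (2 π i t)`
(so `fourier n t = z ^ n`), with the normalized Lebesgue measure `haarAddCircle`; complex
conjugation `z ↦ conj z` becomes `t ↦ -t`. Mathlib's `fourierCoeff f n` is
`∫ conj z ^ n f(z) dm(z)`. -/

/-! ### Vector-valued `L²` and `H²` -/

section VectorValued

variable (E : Type*) [NormedAddCommGroup E] [InnerProductSpace ℂ E] [CompleteSpace E]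

/-- The Hilbert space `L²_E` of (classes of) square-integrable `E`-valued functions. -/
abbrev L2 : Type _ := Lp E 2 (haarAddCircle (T := (1 : ℝ)))

variable {E}

theorem norm_fourier_apply (n : ℤ) (t : UnitAddCircle) : ‖fourier n t‖ = 1 :=
  Circle.norm_coe _

theorem integrable_coe (f : L2 E) :
    Integrable (f : UnitAddCircle → E) (haarAddCircle (T := (1 : ℝ))) :=
  (Lp.memLp f).integrable (by norm_num)

theorem fourierCoeff_congr {f g : UnitAddCircle → E}
    (h : f =ᵐ[haarAddCircle (T := (1 : ℝ))] g) (n : ℤ) : fourierCoeff f n = fourierCoeff g n := by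
  unfold fourierCoeff
  refine integral_congr_ae ?_
  filter_upwards [h] with t ht
  rw [ht]

theorem norm_fourierCoeff_le (f : L2 E) (n : ℤ) :
    ‖fourierCoeff (f : UnitAddCircle → E) n‖ ≤ ‖f‖ := by
  have h1 : ‖fourierCoeff (f : UnitAddCircle → E) n‖
      ≤ ∫ t, ‖(f : UnitAddCircle → E) t‖ ∂(haarAddCircle (T := (1 : ℝ))) := by
    refine (norm_integral_le_integral_norm _).trans (le_of_eq ?_)
    refine integral_congr_ae (Eventually.of_forall fun t => ?_)
    simp only [norm_smul, norm_fourier_apply, one_mul]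
  refine h1.trans ?_
  rw [integral_norm_eq_lintegral_enorm (Lp.aestronglyMeasurable f), Lp.norm_def,
    ← eLpNorm_one_eq_lintegral_enorm]
  exact ENNReal.toReal_mono (Lp.eLpNorm_ne_top f)
    (eLpNorm_le_eLpNorm_of_exponent_le (by norm_num) (Lp.aestronglyMeasurable f))

/-- The `n`-th Fourier coefficient as a continuous linear map on `L²_E`. -/
def fourierCoeffL (n : ℤ) : L2 E →L[ℂ] E :=
  LinearMap.mkContinuous
    { toFun := fun f => fourierCoeff (f : UnitAddCircle → E) n
      map_add' := fun f g => by
        rw [fourierCoeff_congr (Lp.coeFn_add f g) n,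
          fourierCoeff.add (integrable_coe f) (integrable_coe g)]
        rfl
      map_smul' := fun c f => by
        rw [fourierCoeff_congr (Lp.coeFn_smul c f) n]
        exact fourierCoeff.const_smul _ c n } 1
    (fun f => by simpa using norm_fourierCoeff_le f n)

theorem fourierCoeffL_apply (n : ℤ) (f : L2 E) :
    fourierCoeffL n f = fourierCoeff (f : UnitAddCircle → E) n := rfl

variable (E) in
/-- The Hardy space `H²_E`: the functions in `L²_E` whose negative Fourier coefficients vanish. -/
def hardy : Submodule ℂ (L2 E) where
  carrier := {f | ∀ n : ℤ, n < 0 → fourierCoeff (f : UnitAddCircle → E) n = 0}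
  add_mem' := fun {f g} hf hg n hn => by
    rw [← fourierCoeffL_apply, map_add, fourierCoeffL_apply, fourierCoeffL_apply, hf n hn,
      hg n hn, add_zero]
  zero_mem' := fun n _ => by rw [← fourierCoeffL_apply, map_zero]
  smul_mem' := fun c f hf n hn => by
    rw [← fourierCoeffL_apply, map_smul, fourierCoeffL_apply, hf n hn, smul_zero]

theorem mem_hardy {f : L2 E} :
    f ∈ hardy E ↔ ∀ n : ℤ, n < 0 → fourierCoeff (f : UnitAddCircle → E) n = 0 := Iff.rfl

theorem isClosed_hardy : IsClosed (hardy E : Set (L2 E)) := by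
  have : (hardy E : Set (L2 E)) = ⋂ (n : ℤ) (_ : n < 0), {f | fourierCoeffL n f = 0} := by
    ext f
    simp only [SetLike.mem_coe, mem_hardy, Set.mem_iInter, Set.mem_ofPred_eq, fourierCoeffL_apply]
  rw [this]
  exact isClosed_iInter fun n => isClosed_iInter fun _ =>
    isClosed_eq (fourierCoeffL n).continuous continuous_const

instance : CompleteSpace (hardy E) := (isClosed_hardy (E := E)).completeSpace_coe

theorem memLp_mulZ (f : L2 E) :
    MemLp (fun t : UnitAddCircle => fourier 1 t • (f : UnitAddCircle → E) t) 2
      (haarAddCircle (T := (1 : ℝ))) := by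
  refine (Lp.memLp f).of_le
    ((fourier 1).continuous.aestronglyMeasurable.smul (Lp.aestronglyMeasurable f)) ?_
  exact Eventually.of_forall fun t => by rw [norm_smul, norm_fourier_apply, one_mul]

/-- Multiplication by `z` on `L²_E`. -/
def mulZ : L2 E →L[ℂ] L2 E :=
  LinearMap.mkContinuous
    { toFun := fun f => (memLp_mulZ f).toLp _
      map_add' := fun f g => by
        rw [← MemLp.toLp_add]
        refine (MemLp.toLp_eq_toLp_iff _ _).2 ?_
        filter_upwards [Lp.coeFn_add f g] with t ht
        simp only [ht, Pi.add_apply, smul_add]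
      map_smul' := fun c f => by
        rw [RingHom.id_apply, ← MemLp.toLp_const_smul]
        refine (MemLp.toLp_eq_toLp_iff _ _).2 ?_
        filter_upwards [Lp.coeFn_smul c f] with t ht
        simp only [ht, Pi.smul_apply]
        rw [smul_comm] } 1
    (fun f => by
      rw [one_mul]
      refine Lp.norm_le_norm_of_ae_le ?_
      filter_upwards [MemLp.coeFn_toLp (memLp_mulZ f)] with t ht
      simp only [LinearMap.coe_mk, AddHom.coe_mk]
      rw [ht, norm_smul, norm_fourier_apply, one_mul])

theorem coeFn_mulZ (f : L2 E) :
    (mulZ f : UnitAddCircle → E) =ᵐ[haarAddCircle (T := (1 : ℝ))]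
      fun t => fourier 1 t • (f : UnitAddCircle → E) t :=
  MemLp.coeFn_toLp (memLp_mulZ f)

theorem fourierCoeff_mulZ (f : L2 E) (n : ℤ) :
    fourierCoeff (mulZ f : UnitAddCircle → E) n
      = fourierCoeff (f : UnitAddCircle → E) (n - 1) := by
  rw [fourierCoeff_congr (coeFn_mulZ f) n]
  unfold fourierCoeff
  congr 1
  funext t
  rw [smul_smul, ← fourier_add]
  congr 2
  ring_nf

variable (E) in
/-- The shift operator `S_E` on `H²_E`: `(S_E f)(z) = z f(z)`. -/
def shift : hardy E →L[ℂ] hardy E :=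
  (mulZ (E := E)).restrict (p := hardy E) (q := hardy E) (fun f hf n hn => by
    rw [fourierCoeff_mulZ]
    exact hf (n - 1) (by omega))

theorem coe_shift (f : hardy E) : (shift E f : L2 E) = mulZ (f : L2 E) := rfl

variable (E) in
/-- The backward shift operator `S_E^*`, the Hilbert space adjoint of the shift. -/
def backwardShift : hardy E →L[ℂ] hardy E := ContinuousLinearMap.adjoint (shift E)

/-- The value at a point `ζ` of the open unit disk of the analytic function
`g(ζ) = ∑ ĝ(n) ζⁿ` that is identified with `g ∈ H²_E`. -/
def evalDisk (g : hardy E) (ζ : ℂ) : E :=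
  ∑' n : ℕ, ζ ^ n • fourierCoeff ((g : L2 E) : UnitAddCircle → E) n

end VectorValued

/-! ### Dimension and spectral multiplicity -/

/-- The dimension of a complex vector space, as an element of `{0, 1, 2, …, ∞}`. -/
def edim (V : Type*) [AddCommMonoid V] [Module ℂ V] : ℕ∞ := Cardinal.toENat (Module.rank ℂ V)

/-- The spectral multiplicity `μ_T`: the infimum of `dim F` over the subspaces `F` such that the
closed linear span of `⋃ₙ Tⁿ F` is the whole space. -/
def spectralMultiplicity {H : Type*} [AddCommMonoid H] [Module ℂ H] [TopologicalSpace H]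
    [ContinuousAdd H] [ContinuousConstSMul ℂ H] (T : H →L[ℂ] H) : ℕ∞ :=
  ⨅ (F : Submodule ℂ H)
    (_ : (⨆ n : ℕ, F.map ((T ^ n : H →L[ℂ] H) : H →ₗ[ℂ] H)).topologicalClosure = ⊤),
    edim F

/-! ### Degree of non-cyclicity -/

section NonCyclicity

variable {E : Type*} [NormedAddCommGroup E] [InnerProductSpace ℂ E] [CompleteSpace E]

/-- `E_F^*`, the smallest closed `S_E^*`-invariant subspace of `H²_E` containing `F`: the closed
linear span of `⋃ₙ (S_E^*)ⁿ F`. -/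
def cyclicSpan (F : Set (hardy E)) : Submodule ℂ (hardy E) :=
  (Submodule.span ℂ (⋃ n : ℕ, (fun f => (backwardShift E ^ n) f) '' F)).topologicalClosure

/-- The degree of non-cyclicity `nc(F) = sup_{ζ ∈ 𝔻} dim {g(ζ) : g ∈ H²_E ⊖ E_F^*}`. (The set
on the right is a linear subspace of `E`, so it is its own span.) -/
def nc (F : Set (hardy E)) : ℕ∞ :=
  ⨆ (ζ : ℂ) (_ : ‖ζ‖ < 1),
    edim (Submodule.span ℂ ((fun g => evalDisk g ζ) '' ((cyclicSpan F)ᗮ : Set (hardy E))))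

end NonCyclicity

/-! ### Operator-valued functions -/

section OperatorValued

variable {D D₁ D₂ E E' : Type*}
  [NormedAddCommGroup D] [InnerProductSpace ℂ D] [CompleteSpace D]
  [NormedAddCommGroup D₁] [InnerProductSpace ℂ D₁] [CompleteSpace D₁]
  [NormedAddCommGroup D₂] [InnerProductSpace ℂ D₂] [CompleteSpace D₂]
  [NormedAddCommGroup E] [InnerProductSpace ℂ E] [CompleteSpace E]
  [NormedAddCommGroup E'] [InnerProductSpace ℂ E'] [CompleteSpace E']

/-- Strong `L²`-functions, the class `L²_s(B(D,E))`: `Φ(·)x ∈ L²_E` for every `x ∈ D`. -/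
def StrongL2 (Φ : UnitAddCircle → D →L[ℂ] E) : Prop :=
  ∀ x : D, MemLp (fun t => Φ t x) 2 (haarAddCircle (T := (1 : ℝ)))

/-- The class `H²_s(B(D,E))`: strong `L²`-functions with `Φ(·)x ∈ H²_E` for every `x ∈ D`. -/
def StrongH2 (Φ : UnitAddCircle → D →L[ℂ] E) : Prop :=
  StrongL2 Φ ∧ ∀ (x : D) (n : ℤ), n < 0 → fourierCoeff (fun t => Φ t x) n = 0

/-- The class `H^∞(B(D,E))`: essentially bounded measurable functions whose negative Fourier
coefficients vanish. -/
def HInfty (Φ : UnitAddCircle → D →L[ℂ] E) : Prop :=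
  (∀ x : D, AEStronglyMeasurable (fun t => Φ t x) (haarAddCircle (T := (1 : ℝ)))) ∧
  (∃ C : ℝ, ∀ᵐ t ∂(haarAddCircle (T := (1 : ℝ))), ‖Φ t‖ ≤ C) ∧
  ∀ (x : D) (n : ℤ), n < 0 → fourierCoeff (fun t => Φ t x) n = 0

/-- Inner functions with values in `B(D,E)`: `Δ ∈ H^∞(B(D,E))` with `Δ^* Δ = I_D` a.e. -/
def IsInner (Δ : UnitAddCircle → D →L[ℂ] E) : Prop :=
  HInfty Δ ∧ ∀ᵐ t ∂(haarAddCircle (T := (1 : ℝ))),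
    (ContinuousLinearMap.adjoint (Δ t)).comp (Δ t) = ContinuousLinearMap.id ℂ D

/-- `Φ̃(z) = Φ(conj z)^*`. -/
def tilde (Φ : UnitAddCircle → D →L[ℂ] E) : UnitAddCircle → E →L[ℂ] D :=
  fun t => ContinuousLinearMap.adjoint (Φ (-t))

/-- `Ω` is a left inner divisor of `Φ`: `Ω` is inner and `Φ = Ω A` for some
`A ∈ H²_s(B(D,D'))`. -/
def IsLeftInnerDivisor (Ω : UnitAddCircle → D₁ →L[ℂ] E) (Φ : UnitAddCircle → D →L[ℂ] E) : Prop :=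
  IsInner Ω ∧ ∃ A : UnitAddCircle → D →L[ℂ] D₁, StrongH2 A ∧
    ∀ᵐ t ∂(haarAddCircle (T := (1 : ℝ))), Φ t = (Ω t).comp (A t)

/-- `Φ` and `Ψ` are left coprime: their only common left inner divisors are the (constant)
unitary operators. (Up to isometric isomorphism every separable Hilbert space lives in `Type`.) -/
def LeftCoprime (Φ : UnitAddCircle → D₁ →L[ℂ] E) (Ψ : UnitAddCircle → D₂ →L[ℂ] E) : Prop :=
  ∀ (D' : Type) [NormedAddCommGroup D'] [InnerProductSpace ℂ D'] [CompleteSpace D']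
    [TopologicalSpace.SeparableSpace D'] (Ω : UnitAddCircle → D' →L[ℂ] E),
    IsLeftInnerDivisor Ω Φ → IsLeftInnerDivisor Ω Ψ →
      ∃ U : D' ≃ₗᵢ[ℂ] E, ∀ᵐ t ∂(haarAddCircle (T := (1 : ℝ))), ∀ x, Ω t x = U x

/-- `Φ` and `Ψ` are right coprime: `Φ̃` and `Ψ̃` are left coprime. -/
def RightCoprime (Φ : UnitAddCircle → E →L[ℂ] D₁) (Ψ : UnitAddCircle → E →L[ℂ] D₂) : Prop :=
  LeftCoprime (tilde Φ) (tilde Ψ)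

/-- The set `{Φ₊}` of the column vectors `Φ₊ dₖ = P₊(Φ(·)dₖ)` of the analytic part of a strong
`L²`-function `Φ`, with respect to an orthonormal basis `(dₖ)` of `D`. -/
def analyticColumns {ι : Type*} (d : HilbertBasis ι ℂ D) {Φ : UnitAddCircle → D →L[ℂ] E}
    (hΦ : StrongL2 Φ) : Set (hardy E) :=
  Set.range fun k => (hardy E).orthogonalProjectionOnto ((hΦ (d k)).toLp _)

/-- `Φ = Δ A^* + B` is a canonical decomposition of the strong `L²`-function `Φ` with values in
`B(D,E)`, where `Δ` has values in `B(E',E)` and `A` has values in `B(E',D)`. -/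
structure IsCanonicalDecomposition (Φ : UnitAddCircle → D →L[ℂ] E)
    (Δ : UnitAddCircle → E' →L[ℂ] E) (A : UnitAddCircle → E' →L[ℂ] D)
    (B : UnitAddCircle → D →L[ℂ] E) : Prop where
  strongL2 : StrongL2 Φ
  eq_add : ∀ᵐ t ∂(haarAddCircle (T := (1 : ℝ))),
    Φ t = (Δ t).comp (ContinuousLinearMap.adjoint (A t)) + B t
  isInner : IsInner Δ
  strongH2_tilde : StrongH2 (tilde A)
  strongL2_right : StrongL2 B
  rightCoprime : RightCoprime Δ A
  adjoint_comp : ∀ᵐ t ∂(haarAddCircle (T := (1 : ℝ))),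
    (ContinuousLinearMap.adjoint (Δ t)).comp (B t) = 0
  nc_le : ∀ (ι : Type) (d : HilbertBasis ι ℂ D), nc (analyticColumns d strongL2) ≤ edim E'

/-- The Beurling degree `deg_B(Δ)`: the infimum of `dim D ∈ {1, 2, …, ∞}` over the separable
Hilbert spaces `D ≠ {0}` for which there are `A`, `B` such that `Φ = Δ A^* + B` is a canonical
decomposition of some strong `L²`-function `Φ` with values in `B(D,E)`. -/
def beurlingDegree (Δ : UnitAddCircle → E' →L[ℂ] E) : ℕ∞ :=
  sInf {m : ℕ∞ | ∃ (D : Type) (_ : NormedAddCommGroup D) (_ : InnerProductSpace ℂ D)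
    (_ : CompleteSpace D) (_ : TopologicalSpace.SeparableSpace D) (_ : Nontrivial D)
    (Φ : UnitAddCircle → D →L[ℂ] E) (A : UnitAddCircle → E' →L[ℂ] D)
    (B : UnitAddCircle → D →L[ℂ] E), IsCanonicalDecomposition Φ Δ A B ∧ m = edim D}

/-! ### Model spaces -/

/-- The subspace `Δ H²_{E'}` of `H²_E`. -/
def rangeH2 (Δ : UnitAddCircle → E' →L[ℂ] E) : Submodule ℂ (hardy E) where
  carrier := {g | ∃ f : hardy E', ((g : L2 E) : UnitAddCircle → E)
    =ᵐ[haarAddCircle (T := (1 : ℝ))] fun t => Δ t (((f : L2 E') : UnitAddCircle → E') t)}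
  add_mem' := by
    rintro g₁ g₂ ⟨f₁, h₁⟩ ⟨f₂, h₂⟩
    refine ⟨f₁ + f₂, ?_⟩
    filter_upwards [h₁, h₂, Lp.coeFn_add (g₁ : L2 E) (g₂ : L2 E),
      Lp.coeFn_add (f₁ : L2 E') (f₂ : L2 E')] with t k₁ k₂ k₃ k₄
    rw [Submodule.coe_add, Submodule.coe_add, k₃, k₄, Pi.add_apply, Pi.add_apply, k₁, k₂, map_add]
  zero_mem' := by
    refine ⟨0, ?_⟩
    filter_upwards [Lp.coeFn_zero E 2 (haarAddCircle (T := (1 : ℝ))),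
      Lp.coeFn_zero E' 2 (haarAddCircle (T := (1 : ℝ)))] with t k₁ k₂
    rw [Submodule.coe_zero, Submodule.coe_zero, k₁, k₂, Pi.zero_apply, Pi.zero_apply, map_zero]
  smul_mem' := by
    rintro c g ⟨f, h⟩
    refine ⟨c • f, ?_⟩
    filter_upwards [h, Lp.coeFn_smul c (g : L2 E), Lp.coeFn_smul c (f : L2 E')] with t k₁ k₂ k₃
    rw [Submodule.coe_smul, Submodule.coe_smul, k₂, k₃, Pi.smul_apply, Pi.smul_apply, k₁, map_smul]

/-- The model space `H(Δ) = H²_E ⊖ Δ H²_{E'}`. -/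
def modelSpace (Δ : UnitAddCircle → E' →L[ℂ] E) : Submodule ℂ (hardy E) := (rangeH2 Δ)ᗮ

theorem shift_mem_rangeH2 (Δ : UnitAddCircle → E' →L[ℂ] E) {g : hardy E} (hg : g ∈ rangeH2 Δ) :
    shift E g ∈ rangeH2 Δ := by
  obtain ⟨f, h⟩ := hg
  refine ⟨shift E' f, ?_⟩
  filter_upwards [h, coeFn_mulZ (g : L2 E), coeFn_mulZ (f : L2 E')] with t k₁ k₂ k₃
  rw [coe_shift, coe_shift, k₂, k₃, k₁, map_smul]

theorem backwardShift_mem_modelSpace (Δ : UnitAddCircle → E' →L[ℂ] E) (f : hardy E)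
    (hf : f ∈ modelSpace Δ) : backwardShift E f ∈ modelSpace Δ := by
  intro g hg
  rw [backwardShift, ContinuousLinearMap.adjoint_inner_right]
  exact hf _ (shift_mem_rangeH2 Δ hg)

/-- The model operator `S_E^*|_{H(Δ)}`. -/
def modelOperator (Δ : UnitAddCircle → E' →L[ℂ] E) : modelSpace Δ →L[ℂ] modelSpace Δ :=
  (backwardShift E).restrict (p := modelSpace Δ) (q := modelSpace Δ)
    (backwardShift_mem_modelSpace Δ)

end OperatorValued

end Beurling

end

noncomputable section

namespace Beurling

/-! ### Fourier coefficients -/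

section Coefficients

variable {E : Type*} [NormedAddCommGroup E] [InnerProductSpace ℂ E] [CompleteSpace E]

/-! To `Φ` attach the closed shift-invariant space `M` of all `g ∈ H²_E` for which no `⟪g, Φ d⟫` has
a Fourier coefficient of positive index (`coanalyticAnnihilator`). The `k`-th coefficient, `k ≥ 0`,
is the inner product of `zᵏ g` with `Φ d`, so `M` is the orthogonal complement of the backward shift
orbits of the vectors `S^* P₊(Φ d)`. Both inequalities rest on comparing `M` with `Δ H²`.

For `μ_T ≤ deg_B`, let `Φ = Δ A^* + B` be canonical. Then `Δ^* Φ = A^*` is coanalytic, so `Δ H² ⊆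
M`. Conversely `z M` lies in the complement of `E_F^*` for `F = {Φ₊}`, so its values at each point
of the disk span at most `dim E'` dimensions. Elements of `M ⊖ z M` have constant pointwise inner
products, and radial limits of Gram determinants bound its dimension by `dim E'`
(`rank_wandering_le`). Since `M` is generated by its wandering subspace (`le_of_wandering_le`), `M =
Θ H²` with `Θ` inner and no wider than `Δ`. In `Δ = Θ C` the factor `C` is then square and two-sided
inner, and `C̃` divides both `Δ̃` and `Ã`; coprimality makes `C` a constant unitary, whence `M = Δ
H²` (`IsCanonicalDecomposition.coanalyticAnnihilator_le`). The vectors `S^* P₊(Φ d)` thus generate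
the model space.

For `deg_B ≤ μ_T`, take finitely many generators `fᵢ` of the model space and let `Φ` have the
columns `z fᵢ`, with `A^* = Δ^* Φ` and `B = Φ - Δ Δ^* Φ`. Orthogonality of the `fᵢ` to `Δ H²` makes
`A^*` coanalytic, while generation gives both coprimality (`rightCoprime_of_generators`) and the
bound on the degree of non-cyclicity. -/

theorem inner_fourierCoeff {f : UnitAddCircle → E} (hf : Integrable f haarAddCircle) (x : E)
    (n : ℤ) : ⟪x, fourierCoeff f n⟫_ℂ = fourierCoeff (fun t => ⟪x, f t⟫_ℂ) n := by
  unfold fourierCoeff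
  rw [← integral_inner (hf.fourier_smul (-n))]
  simp only [inner_smul_right, smul_eq_mul]

theorem fourierCoeff_comp_neg (f : UnitAddCircle → E) (n : ℤ) :
    fourierCoeff (fun t => f (-t)) n = fourierCoeff f (-n) := by
  unfold fourierCoeff
  rw [← integral_neg_eq_self]
  simp only [neg_neg, fourier_apply, smul_neg, neg_smul]

theorem fourierCoeff_conj (f : UnitAddCircle → ℂ) (n : ℤ) :
    fourierCoeff (fun t => (starRingEnd ℂ) (f t)) n = (starRingEnd ℂ) (fourierCoeff f (-n)) := by
  unfold fourierCoeff
  rw [← integral_conj]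
  simp only [smul_eq_mul, map_mul, ← fourier_neg, neg_neg]

theorem fourierCoeff_inner_swap (f g : UnitAddCircle → E) (n : ℤ) :
    fourierCoeff (fun t => ⟪f t, g t⟫_ℂ) n
      = (starRingEnd ℂ) (fourierCoeff (fun t => ⟪g t, f t⟫_ℂ) (-n)) := by
  rw [← fourierCoeff_conj]
  simp only [inner_conj_symm]

theorem fourierCoeff_fourier_smul (f : UnitAddCircle → E) (m n : ℤ) :
    fourierCoeff (fun t => fourier m t • f t) n = fourierCoeff f (n - m) := by
  unfold fourierCoeff
  congr 1
  funext t
  rw [smul_smul, ← fourier_add]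
  congr 2
  ring_nf

theorem ae_comp_neg {p : UnitAddCircle → Prop}
    (h : ∀ᵐ t ∂(haarAddCircle (T := (1 : ℝ))), p t) :
    ∀ᵐ t ∂(haarAddCircle (T := (1 : ℝ))), p (-t) :=
  (Measure.measurePreserving_neg (haarAddCircle (T := (1 : ℝ)))).quasiMeasurePreserving.ae h

theorem memLp_comp_neg {f : UnitAddCircle → E} {p : ℝ≥0∞}
    (hf : MemLp f p (haarAddCircle (T := (1 : ℝ)))) :
    MemLp (fun t => f (-t)) p (haarAddCircle (T := (1 : ℝ))) :=
  hf.comp_measurePreserving (Measure.measurePreserving_neg (haarAddCircle (T := (1 : ℝ))))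

/-- Integration against `h` is a functional bounded in sup norm by the `L¹` norm of `h`, and it
kills the trigonometric polynomials, which are uniformly dense. -/
theorem integral_continuous_mul_eq_zero {h : UnitAddCircle → ℂ} (hh : Integrable h haarAddCircle)
    (h0 : ∀ n, fourierCoeff h n = 0) (φ : C(UnitAddCircle, ℂ)) :
    ∫ t, φ t * h t ∂(haarAddCircle (T := (1 : ℝ))) = 0 := by
  have hint : ∀ φ : C(UnitAddCircle, ℂ), Integrable (fun t => φ t * h t) haarAddCircle := fun φ =>
    hh.bdd_mul φ.continuous.aestronglyMeasurable
      (Eventually.of_forall fun t => φ.norm_coe_le_norm t)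
  let L : C(UnitAddCircle, ℂ) →L[ℂ] ℂ := LinearMap.mkContinuous
    { toFun := fun φ => ∫ t, φ t * h t ∂(haarAddCircle (T := (1 : ℝ)))
      map_add' := fun φ ψ => by
        rw [← integral_add (hint φ) (hint ψ)]
        simp only [ContinuousMap.add_apply, add_mul]
      map_smul' := fun c φ => by
        simp only [ContinuousMap.smul_apply, smul_eq_mul, RingHom.id_apply, mul_assoc,
          integral_const_mul] }
    (∫ t, ‖h t‖ ∂(haarAddCircle (T := (1 : ℝ)))) fun φ => by
      refine (norm_integral_le_integral_norm _).trans ?_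
      rw [mul_comm, ← integral_const_mul]
      refine integral_mono (hint φ).norm (hh.norm.const_mul _) fun t => ?_
      simp only [norm_mul]
      gcongr
      exact φ.norm_coe_le_norm t
  have hL : L = 0 := by
    refine ContinuousLinearMap.ext_on (s := Set.range (fourier (T := (1 : ℝ)))) ?_ ?_
    · have := span_fourier_closure_eq_top (T := (1 : ℝ))
      rw [← Submodule.dense_iff_topologicalClosure_eq_top] at this
      exact this
    · rintro _ ⟨n, rfl⟩
      have := h0 (-n)
      simpa [fourierCoeff, L] using this
  exact DFunLike.congr_fun hL φ

/-- An integrable function on the circle is determined by its Fourier coefficients. -/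
theorem ae_eq_zero_of_fourierCoeff {h : UnitAddCircle → ℂ} (hh : Integrable h haarAddCircle)
    (h0 : ∀ n, fourierCoeff h n = 0) : h =ᵐ[haarAddCircle (T := (1 : ℝ))] 0 := by
  -- The indicator of a closed set is a pointwise limit of continuous functions bounded by 1, so
  -- dominated convergence passes from continuous test functions to closed sets.
  refine ae_eq_zero_of_forall_setIntegral_isClosed_eq_zero hh fun s hs => ?_
  have hlim : Tendsto (fun n => ∫ t, ((hs.apprSeq n t : ℝ) : ℂ) * h t
      ∂(haarAddCircle (T := (1 : ℝ)))) atTop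
      (nhds (∫ t, s.indicator h t ∂(haarAddCircle (T := (1 : ℝ))))) := by
    refine tendsto_integral_of_dominated_convergence (fun t => ‖h t‖) (fun n => ?_) hh.norm
      (fun n => Eventually.of_forall fun t => ?_) (Eventually.of_forall fun t => ?_)
    · refine AEStronglyMeasurable.mul ?_ hh.1
      exact (Complex.continuous_ofReal.comp (NNReal.continuous_coe.comp
        (hs.apprSeq n).continuous)).aestronglyMeasurable
    · rw [norm_mul, Complex.norm_real, NNReal.norm_eq]
      refine mul_le_of_le_one_left (norm_nonneg _) ?_
      exact_mod_cast HasOuterApproxClosed.apprSeq_apply_le_one hs n t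
    · have h1 := tendsto_pi_nhds.1 (HasOuterApproxClosed.tendsto_apprSeq hs) t
      have h2 : Tendsto (fun n => ((hs.apprSeq n t : ℝ) : ℂ)) atTop
          (nhds (((s.indicator (fun _ => (1 : NNReal)) t : NNReal) : ℝ) : ℂ)) :=
        ((Complex.continuous_ofReal.comp NNReal.continuous_coe).tendsto _).comp h1
      have h3 := h2.mul_const (h t)
      convert h3 using 2
      by_cases ht : t ∈ s <;> simp [ht]
  rw [← integral_indicator hs.measurableSet]
  refine tendsto_nhds_unique hlim ?_
  have : ∀ n, ∫ t, ((hs.apprSeq n t : ℝ) : ℂ) * h t ∂(haarAddCircle (T := (1 : ℝ))) = 0 :=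
    fun n => integral_continuous_mul_eq_zero hh h0 ⟨fun t => ((hs.apprSeq n t : ℝ) : ℂ),
      Complex.continuous_ofReal.comp (NNReal.continuous_coe.comp (hs.apprSeq n).continuous)⟩
  simp only [this]
  exact tendsto_const_nhds

theorem fourierCoeff_const (x : E) (n : ℤ) :
    fourierCoeff (fun _ : UnitAddCircle => x) n = if n = 0 then x else 0 := by
  have h1 : fourierCoeff (fun _ : UnitAddCircle => x) n
      = fourierCoeff (fun _ : UnitAddCircle => (1 : ℂ)) n • x := by
    unfold fourierCoeff
    rw [← integral_smul_const]
    simp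
  have h2 : fourierCoeff (fun _ : UnitAddCircle => (1 : ℂ)) n = if n = 0 then 1 else 0 := by
    have := congrFun (fourierCoeff_fourier (T := (1 : ℝ)) 0) n
    have h3 : (fun _ : UnitAddCircle => (1 : ℂ)) = ⇑(fourier (T := (1 : ℝ)) 0) := by
      funext t; exact fourier_zero.symm
    rw [h3, this, Pi.single_apply]
  rw [h1, h2]
  split_ifs <;> simp

theorem fourierCoeff_sub {f g : UnitAddCircle → E} (hf : Integrable f haarAddCircle)
    (hg : Integrable g haarAddCircle) (n : ℤ) :
    fourierCoeff (fun t => f t - g t) n = fourierCoeff f n - fourierCoeff g n := by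
  unfold fourierCoeff
  rw [← integral_sub (hf.fourier_smul _) (hg.fourier_smul _)]
  simp only [smul_sub]

/-- A function in `L¹_E` whose Fourier coefficients of nonzero index vanish is constant. -/
theorem ae_eq_const_of_fourierCoeff [TopologicalSpace.SeparableSpace E] {h : UnitAddCircle → E}
    (hh : Integrable h haarAddCircle) (h0 : ∀ n, n ≠ 0 → fourierCoeff h n = 0) :
    ∀ᵐ t ∂(haarAddCircle (T := (1 : ℝ))), h t = fourierCoeff h 0 := by
  have : SecondCountableTopology E := UniformSpace.secondCountable_of_separable E
  have hc : Integrable (fun t => h t - fourierCoeff h 0) (haarAddCircle (T := (1 : ℝ))) :=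
    hh.sub (integrable_const _)
  have key : (fun t => h t - fourierCoeff h 0) =ᵐ[haarAddCircle (T := (1 : ℝ))] 0 := by
    refine ae_eq_zero_of_forall_inner (𝕜 := ℂ) fun c => ?_
    refine ae_eq_zero_of_fourierCoeff (hc.const_inner c) fun n => ?_
    rw [← inner_fourierCoeff hc, fourierCoeff_sub hh (integrable_const _), fourierCoeff_const]
    by_cases hn : n = 0
    · subst hn; simp
    · simp [hn, h0 n hn]
  filter_upwards [key] with t ht
  exact sub_eq_zero.1 ht

theorem eq_zero_of_fourierCoeff [TopologicalSpace.SeparableSpace E] {f : L2 E}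
    (h0 : ∀ n, fourierCoeff (f : UnitAddCircle → E) n = 0) : f = 0 := by
  refine (Lp.eq_zero_iff_ae_eq_zero (f := f)).2 ?_
  filter_upwards [ae_eq_const_of_fourierCoeff (integrable_coe f) fun n _ => h0 n] with t ht
  rw [ht, h0, Pi.zero_apply]

end Coefficients

/-! ### Powers of the shift -/

section Shift

variable {E : Type*} [NormedAddCommGroup E] [InnerProductSpace ℂ E] [CompleteSpace E]

theorem coeFn_mulZ_pow (f : L2 E) (n : ℕ) :
    ((mulZ ^ n : L2 E →L[ℂ] L2 E) f : UnitAddCircle → E) =ᵐ[haarAddCircle (T := (1 : ℝ))]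
      fun t => fourier n t • (f : UnitAddCircle → E) t := by
  induction n with
  | zero => exact Eventually.of_forall fun t => by simp
  | succ n ih =>
    rw [pow_succ']
    filter_upwards [coeFn_mulZ ((mulZ ^ n : L2 E →L[ℂ] L2 E) f), ih] with t h1 h2
    rw [mul_apply_eq_comp, h1, h2, smul_smul, ← fourier_add]
    congr 2
    push_cast
    ring_nf

theorem coe_shift_pow (f : hardy E) (n : ℕ) :
    (((shift E ^ n) f : hardy E) : L2 E) = (mulZ ^ n : L2 E →L[ℂ] L2 E) f := by
  induction n with
  | zero => rfl
  | succ n ih =>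
    rw [pow_succ', pow_succ', mul_apply_eq_comp, mul_apply_eq_comp,
      coe_shift, ih]

theorem coeFn_shift_pow (f : hardy E) (n : ℕ) :
    ((((shift E ^ n) f : hardy E) : L2 E) : UnitAddCircle → E)
      =ᵐ[haarAddCircle (T := (1 : ℝ))]
      fun t => fourier n t • ((f : L2 E) : UnitAddCircle → E) t := by
  rw [coe_shift_pow]
  exact coeFn_mulZ_pow _ n

/-- The dictionary used throughout: orthogonality to a shift orbit is the vanishing of the
nonnegative Fourier coefficients of a scalar function. -/
theorem inner_shift_pow (g : hardy E) (f : L2 E) (n : ℕ) :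
    ⟪(((shift E ^ n) g : hardy E) : L2 E), f⟫_ℂ
      = fourierCoeff (fun t => ⟪((g : L2 E) : UnitAddCircle → E) t,
          (f : UnitAddCircle → E) t⟫_ℂ) n := by
  rw [L2.inner_def]
  unfold fourierCoeff
  refine integral_congr_ae ?_
  filter_upwards [coeFn_shift_pow g n] with t ht
  rw [ht, inner_smul_left, fourier_neg, smul_eq_mul]

theorem fourierCoeff_shift_pow (g : hardy E) (n : ℕ) (k : ℤ) :
    fourierCoeff (((shift E ^ n) g : hardy E) : L2 E) k
      = fourierCoeff ((g : L2 E) : UnitAddCircle → E) (k - n) := by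
  rw [fourierCoeff_congr (coeFn_shift_pow g n), fourierCoeff_fourier_smul]

theorem inner_backwardShift_pow (g f : hardy E) (n : ℕ) :
    ⟪g, (backwardShift E ^ n) f⟫_ℂ = ⟪(shift E ^ n) g, f⟫_ℂ := by
  induction n generalizing g with
  | zero => rfl
  | succ n ih =>
    rw [pow_succ', pow_succ, mul_apply_eq_comp, mul_apply_eq_comp,
      backwardShift, ContinuousLinearMap.adjoint_inner_right, ← backwardShift, ih]

theorem inner_shift_shift (g f : hardy E) : ⟪shift E g, shift E f⟫_ℂ = ⟪g, f⟫_ℂ := by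
  rw [Submodule.coe_inner, Submodule.coe_inner, L2.inner_def, L2.inner_def]
  refine integral_congr_ae ?_
  filter_upwards [coeFn_mulZ (g : L2 E), coeFn_mulZ (f : L2 E)] with t h1 h2
  rw [coe_shift, coe_shift, h1, h2, inner_smul_left, inner_smul_right, ← mul_assoc,
    ← fourier_neg, ← fourier_add]
  simp

/-- The shift as a linear isometry. -/
def shiftIsometry (E : Type*) [NormedAddCommGroup E] [InnerProductSpace ℂ E] [CompleteSpace E] :
    hardy E →ₗᵢ[ℂ] hardy E :=
  LinearMap.isometryOfInner (shift E : hardy E →ₗ[ℂ] hardy E) fun g f => inner_shift_shift g f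

/-- The constant function with value `x`, as an element of `H²_E`. -/
def constHardy (x : E) : hardy E :=
  ⟨(memLp_const x).toLp _, fun n hn => by
    rw [fourierCoeff_congr (MemLp.coeFn_toLp (memLp_const x)), fourierCoeff_const,
      if_neg (by omega)]⟩

theorem coeFn_constHardy (x : E) :
    ((constHardy x : L2 E) : UnitAddCircle → E) =ᵐ[haarAddCircle (T := (1 : ℝ))] fun _ => x :=
  MemLp.coeFn_toLp (memLp_const x)

theorem constHardy_add (x y : E) : constHardy (x + y) = constHardy x + constHardy y := by
  refine Subtype.ext (Lp.ext ?_)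
  rw [Submodule.coe_add]
  filter_upwards [coeFn_constHardy x, coeFn_constHardy y, coeFn_constHardy (x + y),
    Lp.coeFn_add (constHardy x : L2 E) (constHardy y : L2 E)] with t h1 h2 h3 h4
  rw [h3, h4, Pi.add_apply, h1, h2]

theorem constHardy_smul (c : ℂ) (x : E) : constHardy (c • x) = c • constHardy x := by
  refine Subtype.ext (Lp.ext ?_)
  rw [Submodule.coe_smul]
  filter_upwards [coeFn_constHardy x, coeFn_constHardy (c • x),
    Lp.coeFn_smul c (constHardy x : L2 E)] with t h1 h3 h4
  rw [h3, h4, Pi.smul_apply, h1]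

theorem inner_shift_pow_constHardy (x : E) (f : hardy E) (n : ℕ) :
    ⟪(shift E ^ n) (constHardy x), f⟫_ℂ
      = ⟪x, fourierCoeff ((f : L2 E) : UnitAddCircle → E) n⟫_ℂ := by
  rw [Submodule.coe_inner, inner_shift_pow, inner_fourierCoeff (integrable_coe _)]
  refine fourierCoeff_congr ?_ n
  filter_upwards [coeFn_constHardy x] with t ht
  rw [ht]

theorem hardy_eq_zero [TopologicalSpace.SeparableSpace E] {f : hardy E}
    (h0 : ∀ n : ℕ, fourierCoeff ((f : L2 E) : UnitAddCircle → E) n = 0) : f = 0 := by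
  refine Subtype.ext (eq_zero_of_fourierCoeff fun n => ?_)
  rcases lt_or_ge n 0 with hn | hn
  · exact f.2 n hn
  · lift n to ℕ using hn
    exact h0 n

/-- The vector-valued analytic polynomials are dense in `H²_E`. -/
theorem closure_span_monomials [TopologicalSpace.SeparableSpace E] :
    (Submodule.span ℂ {g : hardy E | ∃ (n : ℕ) (x : E),
      g = (shift E ^ n) (constHardy x)}).topologicalClosure = ⊤ := by
  rw [Submodule.topologicalClosure_eq_top_iff, Submodule.eq_bot_iff]
  intro f hf
  refine hardy_eq_zero fun n => ?_
  refine ext_inner_left ℂ fun x => ?_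
  rw [inner_zero_right, ← inner_shift_pow_constHardy]
  exact hf _ (Submodule.subset_span ⟨n, x, rfl⟩)

end Shift

/-! ### Multiplication by an inner function -/

section Multiplication

variable {D E : Type*}
  [NormedAddCommGroup D] [InnerProductSpace ℂ D] [CompleteSpace D]
  [NormedAddCommGroup E] [InnerProductSpace ℂ E] [CompleteSpace E]

/-- In a finite orthonormal basis of `D`, the function is a finite sum of measurable scalars times
columns, so measurability of the columns suffices. -/
theorem aestronglyMeasurable_apply [FiniteDimensional ℂ D] {Θ : UnitAddCircle → D →L[ℂ] E}
    (hΘ : ∀ x, AEStronglyMeasurable (fun t => Θ t x) (haarAddCircle (T := (1 : ℝ))))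
    {f : UnitAddCircle → D} (hf : AEStronglyMeasurable f (haarAddCircle (T := (1 : ℝ)))) :
    AEStronglyMeasurable (fun t => Θ t (f t)) (haarAddCircle (T := (1 : ℝ))) := by
  have h : (fun t => Θ t (f t)) = fun t => ∑ i, ⟪stdOrthonormalBasis ℂ D i, f t⟫_ℂ •
      Θ t (stdOrthonormalBasis ℂ D i) := by
    funext t
    conv_lhs => rw [← (stdOrthonormalBasis ℂ D).sum_repr' (f t)]
    simp only [map_sum, map_smul]
  rw [h]
  exact Finset.aestronglyMeasurable_fun_sum _ fun i _ =>
    (hf.const_inner (𝕜 := ℂ)).smul (hΘ _)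

theorem aestronglyMeasurable_adjoint_apply [FiniteDimensional ℂ D]
    {Θ : UnitAddCircle → D →L[ℂ] E}
    (hΘ : ∀ x, AEStronglyMeasurable (fun t => Θ t x) (haarAddCircle (T := (1 : ℝ))))
    {f : UnitAddCircle → E} (hf : AEStronglyMeasurable f (haarAddCircle (T := (1 : ℝ)))) :
    AEStronglyMeasurable (fun t => ContinuousLinearMap.adjoint (Θ t) (f t))
      (haarAddCircle (T := (1 : ℝ))) := by
  have h : (fun t => ContinuousLinearMap.adjoint (Θ t) (f t)) = fun t => ∑ i,
      ⟪Θ t (stdOrthonormalBasis ℂ D i), f t⟫_ℂ • stdOrthonormalBasis ℂ D i := by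
    funext t
    conv_lhs => rw [← (stdOrthonormalBasis ℂ D).sum_repr'
      (ContinuousLinearMap.adjoint (Θ t) (f t))]
    simp only [ContinuousLinearMap.adjoint_inner_right]
  rw [h]
  exact Finset.aestronglyMeasurable_fun_sum _ fun i _ =>
    ((hΘ _).inner (𝕜 := ℂ) hf).smul_const _

theorem IsInner.inner_map {Θ : UnitAddCircle → D →L[ℂ] E} (hΘ : IsInner Θ) :
    ∀ᵐ t ∂(haarAddCircle (T := (1 : ℝ))), ∀ x y, ⟪Θ t x, Θ t y⟫_ℂ = ⟪x, y⟫_ℂ := by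
  filter_upwards [hΘ.2] with t ht x y
  rw [← ContinuousLinearMap.adjoint_inner_right, ← ContinuousLinearMap.comp_apply, ht,
    ContinuousLinearMap.id_apply]

theorem norm_map_of_inner_map {T : D →L[ℂ] E} (hT : ∀ x y, ⟪T x, T y⟫_ℂ = ⟪x, y⟫_ℂ) (x : D) :
    ‖T x‖ = ‖x‖ := by
  rw [@norm_eq_sqrt_re_inner ℂ, @norm_eq_sqrt_re_inner ℂ, hT]

theorem norm_adjoint_apply_le {T : D →L[ℂ] E} (hT : ∀ x y, ⟪T x, T y⟫_ℂ = ⟪x, y⟫_ℂ) (y : E) :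
    ‖ContinuousLinearMap.adjoint T y‖ ≤ ‖y‖ := by
  have h : ‖T‖ ≤ 1 := T.opNorm_le_bound zero_le_one fun x => by
    rw [one_mul, norm_map_of_inner_map hT]
  refine ((ContinuousLinearMap.adjoint T).le_opNorm y).trans ?_
  rw [LinearIsometryEquiv.norm_map]
  exact mul_le_of_le_one_left (norm_nonneg _) h

theorem IsInner.memLp_apply [FiniteDimensional ℂ D] {Θ : UnitAddCircle → D →L[ℂ] E}
    (hΘ : IsInner Θ) {f : UnitAddCircle → D} (hf : MemLp f 2 (haarAddCircle (T := (1 : ℝ)))) :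
    MemLp (fun t => Θ t (f t)) 2 (haarAddCircle (T := (1 : ℝ))) := by
  refine hf.of_le (aestronglyMeasurable_apply hΘ.1.1 hf.1) ?_
  filter_upwards [hΘ.inner_map] with t ht
  exact (norm_map_of_inner_map ht _).le

theorem IsInner.memLp_adjoint_apply [FiniteDimensional ℂ D] {Θ : UnitAddCircle → D →L[ℂ] E}
    (hΘ : IsInner Θ) {f : UnitAddCircle → E} (hf : MemLp f 2 (haarAddCircle (T := (1 : ℝ)))) :
    MemLp (fun t => ContinuousLinearMap.adjoint (Θ t) (f t)) 2
      (haarAddCircle (T := (1 : ℝ))) := by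
  refine hf.of_le (aestronglyMeasurable_adjoint_apply hΘ.1.1 hf.1) ?_
  filter_upwards [hΘ.inner_map] with t ht
  exact norm_adjoint_apply_le ht _

/-- Multiplication by an inner function, as an isometry of `L²` spaces. -/
def mulL2 [FiniteDimensional ℂ D] {Θ : UnitAddCircle → D →L[ℂ] E} (hΘ : IsInner Θ) :
    L2 D →ₗᵢ[ℂ] L2 E where
  toFun f := (hΘ.memLp_apply (Lp.memLp f)).toLp _
  map_add' f g := by
    rw [← MemLp.toLp_add]
    refine (MemLp.toLp_eq_toLp_iff _ _).2 ?_
    filter_upwards [Lp.coeFn_add f g] with t ht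
    simp only [ht, Pi.add_apply, map_add]
  map_smul' c f := by
    rw [RingHom.id_apply, ← MemLp.toLp_const_smul]
    refine (MemLp.toLp_eq_toLp_iff _ _).2 ?_
    filter_upwards [Lp.coeFn_smul c f] with t ht
    simp only [ht, Pi.smul_apply, map_smul]
  norm_map' f := by
    simp only [LinearMap.coe_mk, AddHom.coe_mk]
    rw [Lp.norm_toLp, Lp.norm_def]
    congr 1
    refine eLpNorm_congr_norm_ae ?_
    filter_upwards [hΘ.inner_map] with t ht
    exact norm_map_of_inner_map ht _

theorem coeFn_mulL2 [FiniteDimensional ℂ D] {Θ : UnitAddCircle → D →L[ℂ] E} (hΘ : IsInner Θ)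
    (f : L2 D) : (mulL2 hΘ f : UnitAddCircle → E) =ᵐ[haarAddCircle (T := (1 : ℝ))]
      fun t => Θ t ((f : UnitAddCircle → D) t) :=
  MemLp.coeFn_toLp (hΘ.memLp_apply (Lp.memLp f))

theorem coeFn_mulL2_monomial [FiniteDimensional ℂ D] {Θ : UnitAddCircle → D →L[ℂ] E}
    (hΘ : IsInner Θ) (n : ℕ) (x : D) :
    (mulL2 hΘ (((shift D ^ n) (constHardy x) : hardy D) : L2 D) : UnitAddCircle → E)
      =ᵐ[haarAddCircle (T := (1 : ℝ))] fun t => fourier n t • Θ t x := by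
  filter_upwards [coeFn_mulL2 hΘ (((shift D ^ n) (constHardy x) : hardy D) : L2 D),
    coeFn_shift_pow (constHardy x) n, coeFn_constHardy x] with t h1 h2 h3
  rw [h1, h2, h3, map_smul]

/-- Each negative coefficient is continuous in `f` and vanishes on the monomials `zⁿ x`, because `zⁿ
Θ x` is analytic; monomials span a dense subspace. -/
theorem mulL2_mem_hardy [FiniteDimensional ℂ D] {Θ : UnitAddCircle → D →L[ℂ] E} (hΘ : IsInner Θ)
    {f : L2 D} (hf : f ∈ hardy D) : mulL2 hΘ f ∈ hardy E := by
  intro k hk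
  let L : hardy D →L[ℂ] E :=
    (fourierCoeffL k).comp ((mulL2 hΘ).toContinuousLinearMap.comp (hardy D).subtypeL)
  have hL : L = 0 := by
    refine ContinuousLinearMap.ext_on (Submodule.dense_iff_topologicalClosure_eq_top.2
      (closure_span_monomials (E := D))) ?_
    rintro _ ⟨n, x, rfl⟩
    change fourierCoeff (mulL2 hΘ (((shift D ^ n) (constHardy x) : hardy D) : L2 D) :
      UnitAddCircle → E) k = 0
    rw [fourierCoeff_congr (coeFn_mulL2_monomial hΘ n x), fourierCoeff_fourier_smul]
    exact hΘ.1.2.2 x _ (by omega)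
  exact DFunLike.congr_fun hL ⟨f, hf⟩

/-- Multiplication by an inner function, as an isometry of Hardy spaces. -/
def mulHardy [FiniteDimensional ℂ D] {Θ : UnitAddCircle → D →L[ℂ] E} (hΘ : IsInner Θ) :
    hardy D →ₗᵢ[ℂ] hardy E where
  toLinearMap := (mulL2 hΘ).toLinearMap.restrict fun _ hf => mulL2_mem_hardy hΘ hf
  norm_map' f := (mulL2 hΘ).norm_map f

theorem coeFn_mulHardy [FiniteDimensional ℂ D] {Θ : UnitAddCircle → D →L[ℂ] E} (hΘ : IsInner Θ)
    (f : hardy D) : ((mulHardy hΘ f : L2 E) : UnitAddCircle → E)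
      =ᵐ[haarAddCircle (T := (1 : ℝ))] fun t => Θ t (((f : L2 D) : UnitAddCircle → D) t) :=
  coeFn_mulL2 hΘ f

theorem rangeH2_eq_range [FiniteDimensional ℂ D] {Θ : UnitAddCircle → D →L[ℂ] E}
    (hΘ : IsInner Θ) : rangeH2 Θ = (mulHardy hΘ).range := by
  ext g
  constructor
  · rintro ⟨f, hf⟩
    exact ⟨f, Subtype.ext (Lp.ext ((coeFn_mulHardy hΘ f).trans hf.symm))⟩
  · rintro ⟨f, rfl⟩
    exact ⟨f, coeFn_mulHardy hΘ f⟩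

theorem isClosed_rangeH2 [FiniteDimensional ℂ D] {Θ : UnitAddCircle → D →L[ℂ] E}
    (hΘ : IsInner Θ) : IsClosed (rangeH2 Θ : Set (hardy E)) := by
  rw [rangeH2_eq_range hΘ]
  exact (mulHardy hΘ).isometry.isClosedEmbedding.isClosed_range

theorem mulHardy_shift_pow [FiniteDimensional ℂ D] {Θ : UnitAddCircle → D →L[ℂ] E}
    (hΘ : IsInner Θ) (n : ℕ) (f : hardy D) :
    mulHardy hΘ ((shift D ^ n) f) = (shift E ^ n) (mulHardy hΘ f) := by
  refine Subtype.ext (Lp.ext ?_)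
  filter_upwards [coeFn_mulHardy hΘ ((shift D ^ n) f), coeFn_shift_pow f n,
    coeFn_shift_pow (mulHardy hΘ f) n, coeFn_mulHardy hΘ f] with t h1 h2 h3 h4
  rw [h1, h2, h3, h4, map_smul]

theorem coeFn_mulHardy_const [FiniteDimensional ℂ D] {Θ : UnitAddCircle → D →L[ℂ] E}
    (hΘ : IsInner Θ) (x : D) : ((mulHardy hΘ (constHardy x) : L2 E) : UnitAddCircle → E)
      =ᵐ[haarAddCircle (T := (1 : ℝ))] fun t => Θ t x := by
  filter_upwards [coeFn_mulHardy hΘ (constHardy x), coeFn_constHardy x] with t h1 h2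
  rw [h1, h2]

end Multiplication

/-! ### Values in the disk -/

section Evaluation

variable {E : Type*} [NormedAddCommGroup E] [InnerProductSpace ℂ E] [CompleteSpace E]

theorem norm_pow_smul_fourierCoeff_le (g : hardy E) (ζ : ℂ) (n : ℕ) :
    ‖ζ ^ n • fourierCoeff ((g : L2 E) : UnitAddCircle → E) n‖ ≤ ‖ζ‖ ^ n * ‖g‖ := by
  rw [norm_smul, norm_pow]
  gcongr
  exact norm_fourierCoeff_le (g : L2 E) n

theorem summable_evalDisk (g : hardy E) {ζ : ℂ} (hζ : ‖ζ‖ < 1) :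
    Summable fun n : ℕ => ζ ^ n • fourierCoeff ((g : L2 E) : UnitAddCircle → E) n :=
  Summable.of_norm_bounded ((summable_geometric_of_lt_one (norm_nonneg _) hζ).mul_right ‖g‖)
    (norm_pow_smul_fourierCoeff_le g ζ)

/-- Evaluation at a point of the disk, as a continuous linear map. -/
def evalDiskL {ζ : ℂ} (hζ : ‖ζ‖ < 1) : hardy E →L[ℂ] E :=
  LinearMap.mkContinuous
    { toFun := fun g => evalDisk g ζ
      map_add' := fun f g => by
        unfold evalDisk
        rw [← (summable_evalDisk f hζ).tsum_add (summable_evalDisk g hζ)]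
        refine tsum_congr fun n => ?_
        rw [← smul_add, Submodule.coe_add, ← fourierCoeffL_apply, map_add]
        rfl
      map_smul' := fun c g => by
        unfold evalDisk
        rw [RingHom.id_apply, ← (summable_evalDisk g hζ).tsum_const_smul]
        refine tsum_congr fun n => ?_
        rw [smul_comm, Submodule.coe_smul, ← fourierCoeffL_apply, map_smul]
        rfl } (1 - ‖ζ‖)⁻¹ fun g => by
    refine tsum_of_norm_bounded ?_ (norm_pow_smul_fourierCoeff_le g ζ)
    exact (hasSum_geometric_of_lt_one (norm_nonneg _) hζ).mul_right _

theorem evalDisk_shift (g : hardy E) {ζ : ℂ} (hζ : ‖ζ‖ < 1) :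
    evalDisk (shift E g) ζ = ζ • evalDisk g ζ := by
  unfold evalDisk
  rw [(summable_evalDisk (shift E g) hζ).tsum_eq_zero_add,
    ← (summable_evalDisk g hζ).tsum_const_smul, coe_shift, fourierCoeff_mulZ,
    g.2 _ (by norm_num), smul_zero, zero_add]
  refine tsum_congr fun n => ?_
  rw [fourierCoeff_mulZ, smul_smul, pow_succ']
  congr 2
  push_cast
  ring

theorem evalDisk_shift_pow (g : hardy E) {ζ : ℂ} (hζ : ‖ζ‖ < 1) (n : ℕ) :
    evalDisk ((shift E ^ n) g) ζ = ζ ^ n • evalDisk g ζ := by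
  induction n with
  | zero => simp
  | succ n ih =>
    rw [pow_succ', mul_apply_eq_comp, evalDisk_shift _ hζ, ih, smul_smul, pow_succ']

variable {D : Type*} [NormedAddCommGroup D] [InnerProductSpace ℂ D] [CompleteSpace D]

theorem edim_range_le {V : Type*} {W : Type*} [AddCommGroup V] [Module ℂ V] [AddCommGroup W]
    [Module ℂ W] (f : V →ₗ[ℂ] W) : edim f.range ≤ edim V := by
  have h := OrderHomClass.mono Cardinal.toENat (lift_rank_range_le f)
  simpa [edim] using h

theorem edim_mono {V : Type*} [AddCommGroup V] [Module ℂ V] {p q : Submodule ℂ V} (h : p ≤ q) :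
    edim p ≤ edim q :=
  OrderHomClass.mono Cardinal.toENat (Submodule.rank_mono h)

/-- All values at `ζ` lie in the image of `x ↦ (Θ x)(ζ)`: this holds for `Θ zⁿ x`, and it passes to
limits since a finite-dimensional image is closed. -/
theorem edim_span_evalDisk_rangeH2_le [FiniteDimensional ℂ D] {Θ : UnitAddCircle → D →L[ℂ] E}
    (hΘ : IsInner Θ) {ζ : ℂ} (hζ : ‖ζ‖ < 1) :
    edim (Submodule.span ℂ ((fun g => evalDisk g ζ) '' (rangeH2 Θ : Set (hardy E))))
      ≤ edim D := by
  let c : D →ₗ[ℂ] E := (evalDiskL hζ).toLinearMap ∘ₗ (mulHardy hΘ).toLinearMap ∘ₗ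
    { toFun := constHardy, map_add' := constHardy_add, map_smul' := constHardy_smul }
  refine (edim_mono ?_).trans (edim_range_le c)
  rw [Submodule.span_le]
  rintro _ ⟨g, hg, rfl⟩
  rw [SetLike.mem_coe, rangeH2_eq_range hΘ] at hg
  obtain ⟨f, rfl⟩ := hg
  let p : Submodule ℂ (hardy D) := c.range.comap
    ((evalDiskL hζ).comp (mulHardy hΘ).toContinuousLinearMap).toLinearMap
  have hp : IsClosed (p : Set (hardy D)) := c.range.closed_of_finiteDimensional.preimage
    ((evalDiskL hζ).comp (mulHardy hΘ).toContinuousLinearMap).continuous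
  have hle : Submodule.span ℂ {g : hardy D | ∃ (n : ℕ) (x : D),
      g = (shift D ^ n) (constHardy x)} ≤ p := by
    rw [Submodule.span_le]
    rintro _ ⟨n, x, rfl⟩
    change evalDisk (mulHardy hΘ ((shift D ^ n) (constHardy x))) ζ ∈ c.range
    rw [mulHardy_shift_pow, evalDisk_shift_pow _ hζ]
    exact c.range.smul_mem _ ⟨x, rfl⟩
  have hmem : f ∈ p := by
    have := Submodule.topologicalClosure_minimal _ hle hp
    rw [closure_span_monomials] at this
    exact this Submodule.mem_top
  exact hmem

end Evaluation

/-! ### Parseval's identity and radial limits -/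

section Radial

variable {E : Type*} [NormedAddCommGroup E] [InnerProductSpace ℂ E] [CompleteSpace E]

theorem inner_monomials (n m : ℕ) (x y : E) :
    ⟪(shift E ^ n) (constHardy x), (shift E ^ m) (constHardy y)⟫_ℂ
      = if n = m then ⟪x, y⟫_ℂ else 0 := by
  rw [inner_shift_pow_constHardy, fourierCoeff_shift_pow,
    fourierCoeff_congr (coeFn_constHardy y), fourierCoeff_const]
  by_cases h : n = m
  · simp [h]
  · have : (n : ℤ) - m ≠ 0 := by omega
    simp [h, this]

/-- The isometry `x ↦ zⁿ x` of `E` into `H²_E`. -/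
def monomialIsometry (E : Type*) [NormedAddCommGroup E] [InnerProductSpace ℂ E] [CompleteSpace E]
    (n : ℕ) : E →ₗᵢ[ℂ] hardy E :=
  LinearMap.isometryOfInner
    { toFun := fun x => (shift E ^ n) (constHardy x)
      map_add' := fun x y => by rw [constHardy_add, map_add]
      map_smul' := fun c x => by rw [constHardy_smul, map_smul, RingHom.id_apply] }
    fun x y => (inner_monomials n n x y).trans (if_pos rfl)

theorem monomialIsometry_apply (n : ℕ) (x : E) :
    monomialIsometry E n x = (shift E ^ n) (constHardy x) := rfl

/-- Successive refinement yields one subsequence for all indices; Gram matrices need their entries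
to converge along the same radii. -/
theorem exists_subseq_tendsto_ae {ι : Type*} (s : Finset ι) {F : ι → ℕ → L2 E} {g : ι → L2 E}
    (h : ∀ i, Tendsto (F i) atTop (nhds (g i))) :
    ∃ φ : ℕ → ℕ, StrictMono φ ∧ ∀ i ∈ s, ∀ᵐ t ∂(haarAddCircle (T := (1 : ℝ))),
      Tendsto (fun k => (F i (φ k) : UnitAddCircle → E) t) atTop
        (nhds ((g i : UnitAddCircle → E) t)) := by
  classical
  induction s using Finset.induction_on with
  | empty => exact ⟨id, strictMono_id, by simp⟩
  | insert a s _ ih =>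
    obtain ⟨φ, hφ, hs⟩ := ih
    obtain ⟨ψ, hψ, ha⟩ := (tendstoInMeasure_of_tendsto_Lp
      ((h a).comp hφ.tendsto_atTop)).exists_seq_tendsto_ae
    refine ⟨φ ∘ ψ, hφ.comp hψ, fun i hi => ?_⟩
    rcases Finset.mem_insert.1 hi with rfl | hi
    · exact ha
    · filter_upwards [hs i hi] with t ht
      exact ht.comp hψ.tendsto_atTop

variable [TopologicalSpace.SeparableSpace E]

theorem isHilbertSum_monomialIsometry :
    IsHilbertSum ℂ (fun _ : ℕ => E) (monomialIsometry E) := by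
  refine IsHilbertSum.mk (fun n m hnm x y => ?_) ?_
  · exact (inner_monomials n m x y).trans (if_neg hnm)
  · rw [← closure_span_monomials (E := E)]
    refine Submodule.topologicalClosure_mono ?_
    rw [Submodule.span_le]
    rintro _ ⟨n, x, rfl⟩
    exact Submodule.mem_iSup_of_mem n ⟨x, rfl⟩

/-- The sequence of Taylor coefficients, as an isomorphism of `H²_E` with `ℓ²(E)`. -/
def taylorEquiv (E : Type*) [NormedAddCommGroup E] [InnerProductSpace ℂ E] [CompleteSpace E]
    [TopologicalSpace.SeparableSpace E] : hardy E ≃ₗᵢ[ℂ] lp (fun _ : ℕ => E) 2 :=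
  (isHilbertSum_monomialIsometry (E := E)).linearIsometryEquiv

theorem taylorEquiv_apply (g : hardy E) (n : ℕ) :
    taylorEquiv E g n = fourierCoeff ((g : L2 E) : UnitAddCircle → E) n := by
  refine ext_inner_left ℂ fun x => ?_
  rw [← inner_shift_pow_constHardy, ← monomialIsometry_apply,
    ← (isHilbertSum_monomialIsometry (E := E)).linearIsometryEquiv_symm_apply_single (i := n) x,
    ← lp.inner_single_left n x (taylorEquiv E g), taylorEquiv]
  exact (LinearIsometryEquiv.inner_map_eq_flip _ _ _).symm

theorem hasSum_norm_sq_fourierCoeff (g : hardy E) :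
    HasSum (fun n : ℕ => ‖fourierCoeff ((g : L2 E) : UnitAddCircle → E) n‖ ^ 2) (‖g‖ ^ 2) := by
  have h := lp.hasSum_norm (p := 2) (by norm_num) (taylorEquiv E g)
  simpa [taylorEquiv_apply, LinearIsometryEquiv.norm_map] using h

theorem summable_dilation (g : hardy E) {ρ : ℝ} (h0 : 0 ≤ ρ) (h1 : ρ < 1) :
    Summable fun n : ℕ => (ρ : ℂ) ^ n •
      monomialIsometry E n (fourierCoeff ((g : L2 E) : UnitAddCircle → E) n) := by
  refine Summable.of_norm_bounded ((summable_geometric_of_lt_one h0 h1).mul_right ‖g‖) fun n => ?_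
  rw [norm_smul, LinearIsometry.norm_map, norm_pow, Complex.norm_real, Real.norm_of_nonneg h0]
  gcongr
  exact norm_fourierCoeff_le (g : L2 E) n

/-- The dilation `g(ρ z)` of `g ∈ H²_E`. -/
def dilation (g : hardy E) (ρ : ℝ) : hardy E :=
  ∑' n : ℕ, (ρ : ℂ) ^ n • monomialIsometry E n (fourierCoeff ((g : L2 E) : UnitAddCircle → E) n)

theorem fourierCoeff_dilation (g : hardy E) {ρ : ℝ} (h0 : 0 ≤ ρ) (h1 : ρ < 1) (k : ℕ) :
    fourierCoeff ((dilation g ρ : L2 E) : UnitAddCircle → E) k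
      = (ρ : ℂ) ^ k • fourierCoeff ((g : L2 E) : UnitAddCircle → E) k := by
  have hs := (summable_dilation g h0 h1).hasSum.mapL ((fourierCoeffL k).comp (hardy E).subtypeL)
  refine hs.unique ?_
  convert hasSum_ite_eq k ((ρ : ℂ) ^ k • fourierCoeff ((g : L2 E) : UnitAddCircle → E) k) using 1
  funext n
  rw [map_smul, ContinuousLinearMap.comp_apply, Submodule.subtypeL_apply, fourierCoeffL_apply,
    monomialIsometry_apply, fourierCoeff_shift_pow, fourierCoeff_congr (coeFn_constHardy _),
    fourierCoeff_const]
  by_cases h : n = k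
  · simp [h]
  · have : (k : ℤ) - n ≠ 0 := by omega
    simp [h, this]

/-- For `ρ < 1` the power series converges uniformly on the circle, and its image in `L²` is, term
by term, the series defining the dilation. -/
theorem coeFn_dilation (g : hardy E) {ρ : ℝ} (h0 : 0 ≤ ρ) (h1 : ρ < 1) :
    ((dilation g ρ : L2 E) : UnitAddCircle → E) =ᵐ[haarAddCircle (T := (1 : ℝ))]
      fun t => evalDisk g (ρ * fourier 1 t) := by
  let φ : ℕ → C(UnitAddCircle, E) := fun n =>
    ⟨fun t => (ρ * fourier 1 t : ℂ) ^ n • fourierCoeff ((g : L2 E) : UnitAddCircle → E) n,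
      (((continuous_const.mul (fourier 1).continuous).pow n)).smul continuous_const⟩
  have hφ : Summable φ := by
    refine Summable.of_norm_bounded ((summable_geometric_of_lt_one h0 h1).mul_right ‖g‖)
      fun n => ?_
    refine (ContinuousMap.norm_le _ (by positivity)).2 fun t => ?_
    refine (norm_pow_smul_fourierCoeff_le g _ n).trans (le_of_eq ?_)
    rw [norm_mul, norm_fourier_apply, Complex.norm_real, Real.norm_of_nonneg h0, mul_one]
  have hL2 : HasSum (fun n => ContinuousMap.toLp (E := E) 2 (haarAddCircle (T := (1 : ℝ))) ℂ (φ n))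
      (ContinuousMap.toLp (E := E) 2 (haarAddCircle (T := (1 : ℝ))) ℂ (∑' n, φ n)) :=
    hφ.hasSum.mapL _
  have hterm : ∀ n, ContinuousMap.toLp (E := E) 2 (haarAddCircle (T := (1 : ℝ))) ℂ (φ n)
      = (((ρ : ℂ) ^ n • monomialIsometry E n
        (fourierCoeff ((g : L2 E) : UnitAddCircle → E) n) : hardy E) : L2 E) := by
    intro n
    refine Lp.ext ?_
    rw [Submodule.coe_smul, monomialIsometry_apply]
    filter_upwards [ContinuousMap.coeFn_toLp (p := 2) (𝕜 := ℂ) (haarAddCircle (T := (1 : ℝ))) (φ n),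
      Lp.coeFn_smul ((ρ : ℂ) ^ n) (((shift E ^ n) (constHardy
        (fourierCoeff ((g : L2 E) : UnitAddCircle → E) n)) : hardy E) : L2 E),
      coeFn_shift_pow (constHardy (fourierCoeff ((g : L2 E) : UnitAddCircle → E) n)) n,
      coeFn_constHardy (fourierCoeff ((g : L2 E) : UnitAddCircle → E) n)] with t k1 k2 k3 k4
    rw [k1, k2, Pi.smul_apply, k3, k4, smul_smul]
    simp only [φ, ContinuousMap.coe_mk, mul_pow]
    congr 2
    rw [fourier_apply, fourier_apply, one_zsmul, natCast_zsmul, toCircle_nsmul, Circle.coe_pow]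
  simp only [hterm] at hL2
  have heq := hL2.unique ((summable_dilation g h0 h1).hasSum.mapL (hardy E).subtypeL)
  have heq' : ContinuousMap.toLp (E := E) 2 (haarAddCircle (T := (1 : ℝ))) ℂ (∑' n, φ n)
      = (dilation g ρ : L2 E) := heq
  rw [← heq']
  filter_upwards [ContinuousMap.coeFn_toLp (p := 2) (𝕜 := ℂ) (haarAddCircle (T := (1 : ℝ)))
    (∑' n, φ n)] with t ht
  rw [ht, ← ContinuousMap.tsum_apply hφ]
  rfl

/-- By Parseval the squared distance is the sum of `|ρⁿ - 1|² ‖ĝ(n)‖²`, to which dominated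
convergence for series applies. -/
theorem tendsto_dilation (g : hardy E) {ρ : ℕ → ℝ} (h0 : ∀ k, 0 ≤ ρ k) (h1 : ∀ k, ρ k < 1)
    (hρ : Tendsto ρ atTop (nhds 1)) :
    Tendsto (fun k => dilation g (ρ k)) atTop (nhds g) := by
  rw [tendsto_iff_norm_sub_tendsto_zero]
  have hsq : Tendsto (fun k => ‖dilation g (ρ k) - g‖ ^ 2) atTop (nhds 0) := by
    have hn : ∀ k, ‖dilation g (ρ k) - g‖ ^ 2
        = ∑' n : ℕ, ‖((ρ k : ℂ) ^ n - 1) • fourierCoeff ((g : L2 E) : UnitAddCircle → E) n‖ ^ 2 := by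
      intro k
      rw [← (hasSum_norm_sq_fourierCoeff (dilation g (ρ k) - g)).tsum_eq]
      refine tsum_congr fun n => ?_
      rw [Submodule.coe_sub, ← fourierCoeffL_apply, map_sub, fourierCoeffL_apply,
        fourierCoeffL_apply, fourierCoeff_dilation g (h0 k) (h1 k), sub_smul, one_smul]
    simp only [hn]
    have hz : (∑' _ : ℕ, (0 : ℝ)) = 0 := tsum_zero
    rw [← hz]
    refine tendsto_tsum_of_dominated_convergence
      (bound := fun n : ℕ => ‖fourierCoeff ((g : L2 E) : UnitAddCircle → E) n‖ ^ 2)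
      (hasSum_norm_sq_fourierCoeff g).summable (fun n => ?_) (Eventually.of_forall fun k n => ?_)
    · have : Tendsto (fun k => ((ρ k : ℂ) ^ n - 1) •
          fourierCoeff ((g : L2 E) : UnitAddCircle → E) n) atTop
          (nhds ((((1 : ℝ) : ℂ) ^ n - 1) • fourierCoeff ((g : L2 E) : UnitAddCircle → E) n)) :=
        ((((Complex.continuous_ofReal.tendsto _).comp hρ).pow n).sub_const 1).smul_const _
      simpa using (this.norm.pow 2)
    · rw [Real.norm_of_nonneg (by positivity), norm_smul]
      have : ‖((ρ k : ℂ) ^ n - 1)‖ ≤ 1 := by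
        have h2 : (ρ k : ℂ) ^ n - 1 = ((ρ k ^ n - 1 : ℝ) : ℂ) := by push_cast; ring
        rw [h2, Complex.norm_real, Real.norm_eq_abs, abs_le]
        have h3 := pow_nonneg (h0 k) n
        have h4 := pow_le_one₀ (n := n) (h0 k) (h1 k).le
        constructor <;> linarith
      gcongr
      exact mul_le_of_le_one_left (norm_nonneg _) this
  have := hsq.sqrt
  simpa using this

/-- Finitely many functions in `H²_E` have common radial limits along a sequence of radii. -/
theorem exists_radii_tendsto_ae {ι : Type*} [Fintype ι] (g : ι → hardy E) :
    ∃ ρ : ℕ → ℝ, (∀ k, 0 ≤ ρ k) ∧ (∀ k, ρ k < 1) ∧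
      ∀ᵐ t ∂(haarAddCircle (T := (1 : ℝ))), ∀ i,
        Tendsto (fun k => evalDisk (g i) (ρ k * fourier 1 t)) atTop
          (nhds (((g i : L2 E) : UnitAddCircle → E) t)) := by
  let r : ℕ → ℝ := fun k => 1 - 1 / ((k : ℝ) + 1)
  have hk : ∀ k : ℕ, 0 < 1 / ((k : ℝ) + 1) ∧ 1 / ((k : ℝ) + 1) ≤ 1 := fun k =>
    ⟨by positivity, by rw [div_le_one (by positivity)]; linarith [Nat.cast_nonneg (α := ℝ) k]⟩
  have h0 : ∀ k, 0 ≤ r k := fun k => by linarith [(hk k).2]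
  have h1 : ∀ k, r k < 1 := fun k => by linarith [(hk k).1]
  have hr : Tendsto r atTop (nhds 1) := by
    simpa only [sub_zero] using (tendsto_one_div_add_atTop_nhds_zero_nat (𝕜 := ℝ)).const_sub 1
  obtain ⟨φ, -, hφ⟩ := exists_subseq_tendsto_ae Finset.univ
    (F := fun i k => (dilation (g i) (r k) : L2 E)) (g := fun i => (g i : L2 E))
    fun i => (continuous_subtype_val.tendsto _).comp (tendsto_dilation (g i) h0 h1 hr)
  refine ⟨r ∘ φ, fun k => h0 _, fun k => h1 _, ?_⟩
  rw [ae_all_iff]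
  intro i
  filter_upwards [hφ i (Finset.mem_univ i), ae_all_iff.2 fun k =>
    coeFn_dilation (g i) (h0 (φ k)) (h1 (φ k))] with t ht1 ht2
  simpa only [ht2, Function.comp_apply] using ht1

end Radial

/-! ### Wandering subspaces -/

section Wandering

variable {E : Type*} [NormedAddCommGroup E] [InnerProductSpace ℂ E] [CompleteSpace E]

/-- The wandering subspace `M ⊖ z M` of a subspace `M` of `H²_E`. -/
def wandering (M : Submodule ℂ (hardy E)) : Submodule ℂ (hardy E) :=
  M ⊓ (M.map (shiftIsometry E).toLinearMap)ᗮ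

theorem shift_pow_mem {M : Submodule ℂ (hardy E)} (hinv : ∀ g ∈ M, shift E g ∈ M) {g : hardy E}
    (hg : g ∈ M) (n : ℕ) : (shift E ^ n) g ∈ M := by
  induction n with
  | zero => exact hg
  | succ n ih =>
    rw [pow_succ', mul_apply_eq_comp]
    exact hinv _ ih

/-- Write `g = z h + q` with `q` in the wandering subspace. As `q ∈ N`, it is orthogonal to both `g`
and `z h`, so `q = 0`. Then `h ⊥ N`, because the shift is isometric and preserves `N`. -/
theorem exists_shift_eq_of_mem_orthogonal {M N : Submodule ℂ (hardy E)}
    (hM : IsClosed (M : Set (hardy E))) (hinv : ∀ g ∈ M, shift E g ∈ M)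
    (hNinv : ∀ g ∈ N, shift E g ∈ N) (hW : wandering M ≤ N) {g : hardy E} (hg : g ∈ M)
    (hgN : g ∈ Nᗮ) : ∃ h ∈ M, h ∈ Nᗮ ∧ shift E h = g := by
  let K : Submodule ℂ (hardy E) := M.map (shiftIsometry E).toLinearMap
  have hK : IsClosed (K : Set (hardy E)) :=
    (shiftIsometry E).isometry.isClosedEmbedding.isClosedMap _ hM
  have : CompleteSpace K := hK.completeSpace_coe
  obtain ⟨p, hp, q, hq, rfl⟩ := K.exists_add_mem_mem_orthogonal g
  obtain ⟨h, hh, rfl⟩ := hp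
  have hpM : (shiftIsometry E).toLinearMap h ∈ M := hinv h hh
  have hqW : q ∈ wandering M := ⟨by simpa using M.sub_mem hg hpM, hq⟩
  have hq0 : q = 0 := by
    rw [← inner_self_eq_zero (𝕜 := ℂ)]
    have h1 := hgN q (hW hqW)
    rw [inner_add_right] at h1
    have h2 : ⟪q, (shiftIsometry E).toLinearMap h⟫_ℂ = 0 :=
      Submodule.inner_left_of_mem_orthogonal (K := K) ⟨h, hh, rfl⟩ hq
    rwa [h2, zero_add] at h1
  subst hq0
  rw [add_zero] at hgN ⊢
  refine ⟨h, hh, fun u hu => ?_, rfl⟩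
  rw [← inner_shift_shift]
  exact hgN _ (hNinv u hu)

/-- A closed shift-invariant subspace is generated by its wandering subspace. -/
theorem le_of_wandering_le [TopologicalSpace.SeparableSpace E] {M N : Submodule ℂ (hardy E)}
    (hM : IsClosed (M : Set (hardy E))) (hinv : ∀ g ∈ M, shift E g ∈ M)
    (hN : IsClosed (N : Set (hardy E))) (hNinv : ∀ g ∈ N, shift E g ∈ N)
    (hW : wandering M ≤ N) : M ≤ N := by
  -- Intersecting with `M` keeps the component of `g` orthogonal to `K` inside `M`.
  let K : Submodule ℂ (hardy E) := N ⊓ M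
  have hK : IsClosed (K : Set (hardy E)) := hN.inter hM
  have hKinv : ∀ g ∈ K, shift E g ∈ K := fun g hg => ⟨hNinv g hg.1, hinv g hg.2⟩
  have hWK : wandering M ≤ K := le_inf hW inf_le_left
  -- Elements of `M ⊖ K` can be divided by `z` within `M ⊖ K` indefinitely, which kills every Taylor
  -- coefficient.
  have hcoeff : ∀ (n : ℕ) (g : hardy E), g ∈ M → g ∈ Kᗮ →
      fourierCoeff ((g : L2 E) : UnitAddCircle → E) n = 0 := by
    intro n
    induction n with
    | zero =>
      intro g hg hgK
      obtain ⟨h, -, -, rfl⟩ := exists_shift_eq_of_mem_orthogonal hM hinv hKinv hWK hg hgK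
      rw [coe_shift, fourierCoeff_mulZ]
      exact h.2 _ (by norm_num)
    | succ n ih =>
      intro g hg hgK
      obtain ⟨h, hh, hhK, rfl⟩ := exists_shift_eq_of_mem_orthogonal hM hinv hKinv hWK hg hgK
      rw [coe_shift, fourierCoeff_mulZ]
      simpa using ih h hh hhK
  have : CompleteSpace K := hK.completeSpace_coe
  intro g hg
  obtain ⟨p, hp, q, hq, rfl⟩ := K.exists_add_mem_mem_orthogonal g
  have hqM : q ∈ M := by simpa using M.sub_mem hg hp.2
  rw [hardy_eq_zero fun n => hcoeff n q hqM hq, add_zero]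
  exact hp.1

/-- The elements of a wandering subspace have constant pointwise inner products. -/
theorem inner_ae_eq_of_mem_wandering {M : Submodule ℂ (hardy E)}
    (hinv : ∀ g ∈ M, shift E g ∈ M) {v w : hardy E} (hv : v ∈ wandering M)
    (hw : w ∈ wandering M) : ∀ᵐ t ∂(haarAddCircle (T := (1 : ℝ))),
      ⟪((v : L2 E) : UnitAddCircle → E) t, ((w : L2 E) : UnitAddCircle → E) t⟫_ℂ = ⟪v, w⟫_ℂ := by
  -- Positive coefficients vanish because `zⁿ⁺¹ v ∈ z M` is orthogonal to `w`; exchanging `v` and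
  -- `w` will handle the negative ones.
  have hpos : ∀ v ∈ wandering M, ∀ w ∈ wandering M, ∀ n : ℕ, fourierCoeff
      (fun t => ⟪((v : L2 E) : UnitAddCircle → E) t, ((w : L2 E) : UnitAddCircle → E) t⟫_ℂ)
      ((n + 1 : ℕ) : ℤ) = 0 := by
    intro v hv w hw n
    rw [← inner_shift_pow, ← Submodule.coe_inner, pow_succ', mul_apply_eq_comp]
    exact hw.2 _ ⟨(shift E ^ n) v, shift_pow_mem hinv hv.1 n, rfl⟩
  have h0 := inner_shift_pow v (w : L2 E) 0
  rw [pow_zero, one_apply_eq_self, ← Submodule.coe_inner] at h0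
  rw [h0]
  refine ae_eq_const_of_fourierCoeff (L2.integrable_inner _ _) fun n hn => ?_
  rcases lt_trichotomy n 0 with h | h | h
  · rw [fourierCoeff_inner_swap]
    obtain ⟨m, hm⟩ : ∃ m : ℕ, -n = ((m + 1 : ℕ) : ℤ) := ⟨(-n - 1).toNat, by omega⟩
    rw [hm, hpos w hw v hv, map_zero]
  · exact absurd h hn
  · obtain ⟨m, hm⟩ : ∃ m : ℕ, n = ((m + 1 : ℕ) : ℤ) := ⟨(n - 1).toNat, by omega⟩
    rw [hm, hpos v hv w hw]

theorem det_gram_eq_zero_of_edim_lt {V : Type*} [NormedAddCommGroup V] [InnerProductSpace ℂ V]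
    {ι : Type*} [Fintype ι] [DecidableEq ι] {p : Submodule ℂ V} {u : ι → V} (hu : ∀ i, u i ∈ p)
    (hp : edim p < Fintype.card ι) : (Matrix.gram ℂ u).det = 0 := by
  by_contra h
  have hli := Matrix.linearIndependent_of_det_gram_ne_zero h
  have hli' : LinearIndependent ℂ (fun i => (⟨u i, hu i⟩ : p)) :=
    LinearIndependent.of_comp p.subtype hli
  have hle := OrderHomClass.mono Cardinal.toENat hli'.cardinal_lift_le_rank
  refine absurd hp (not_lt.2 ?_)
  simpa [edim] using hle

/-- The Gram matrix of `w` equals its pointwise version almost everywhere, hence is a radial limit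
of Gram matrices of values of `z wᵢ`. With more than `r` vectors those are singular, and so is the
limit. The factor `z` places the functions in `M'` and, being unimodular, leaves boundary Gram
matrices unchanged. -/
theorem card_le_of_linearIndependent_wandering [TopologicalSpace.SeparableSpace E]
    {M M' : Submodule ℂ (hardy E)} (hinv : ∀ g ∈ M, shift E g ∈ M)
    (hMM' : ∀ g ∈ M, shift E g ∈ M') {r : ℕ}
    (hr : ∀ ζ : ℂ, ‖ζ‖ < 1 →
      edim (Submodule.span ℂ ((fun g => evalDisk g ζ) '' (M' : Set (hardy E)))) ≤ r)
    {ι : Type*} [Fintype ι] {w : ι → hardy E} (hw : ∀ i, w i ∈ wandering M)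
    (hli : LinearIndependent ℂ w) : Fintype.card ι ≤ r := by
  classical
  by_contra! hcard
  obtain ⟨ρ, hρ0, hρ1, hlim⟩ := exists_radii_tendsto_ae fun i => shift E (w i)
  have hin : ∀ᵐ t ∂(haarAddCircle (T := (1 : ℝ))), ∀ i j,
      ⟪((w i : L2 E) : UnitAddCircle → E) t, ((w j : L2 E) : UnitAddCircle → E) t⟫_ℂ
        = ⟪w i, w j⟫_ℂ :=
    ae_all_iff.2 fun i => ae_all_iff.2 fun j => inner_ae_eq_of_mem_wandering hinv (hw i) (hw j)
  have hsh : ∀ᵐ t ∂(haarAddCircle (T := (1 : ℝ))), ∀ i,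
      ((shift E (w i) : L2 E) : UnitAddCircle → E) t
        = fourier 1 t • ((w i : L2 E) : UnitAddCircle → E) t :=
    ae_all_iff.2 fun i => coeFn_mulZ _
  obtain ⟨t, ht1, ht2, ht3⟩ := (hlim.and (hin.and hsh)).exists
  have hgram : Tendsto (fun k => Matrix.gram ℂ fun i =>
      evalDisk (shift E (w i)) (ρ k * fourier 1 t)) atTop (nhds (Matrix.gram ℂ w)) := by
    refine tendsto_pi_nhds.2 fun i => tendsto_pi_nhds.2 fun j => ?_
    have h := (ht1 i).inner (𝕜 := ℂ) (ht1 j)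
    rw [ht3, ht3, inner_smul_left, inner_smul_right, ht2, ← mul_assoc, ← fourier_neg,
      ← fourier_add, neg_add_cancel, fourier_zero, one_mul] at h
    exact h
  have hdet := ((continuous_id.matrix_det).tendsto (Matrix.gram ℂ w)).comp hgram
  have hzero : ∀ k, (Matrix.gram ℂ fun i =>
      evalDisk (shift E (w i)) (ρ k * fourier 1 t)).det = 0 := by
    intro k
    have hζ : ‖(ρ k * fourier 1 t : ℂ)‖ < 1 := by
      rw [norm_mul, norm_fourier_apply, Complex.norm_real, Real.norm_of_nonneg (hρ0 k), mul_one]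
      exact hρ1 k
    refine det_gram_eq_zero_of_edim_lt (p := Submodule.span ℂ
      ((fun g => evalDisk g (ρ k * fourier 1 t)) '' (M' : Set (hardy E)))) (fun i => ?_)
      ((hr _ hζ).trans_lt ?_)
    · exact Submodule.subset_span ⟨_, hMM' _ (hw i).1, rfl⟩
    · exact_mod_cast hcard
  have hlim0 : (Matrix.gram ℂ w).det = 0 := by
    refine tendsto_nhds_unique hdet ?_
    simp only [Function.comp_def, id_eq, hzero]
    exact tendsto_const_nhds
  exact Matrix.det_gram_ne_zero_iff_linearIndependent.2 hli hlim0

/-- If the values of `z M` span spaces of dimension at most `r`, then the wandering subspace of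
`M` has dimension at most `r`. -/
theorem rank_wandering_le [TopologicalSpace.SeparableSpace E] {M M' : Submodule ℂ (hardy E)}
    (hinv : ∀ g ∈ M, shift E g ∈ M) (hMM' : ∀ g ∈ M, shift E g ∈ M') {r : ℕ}
    (hr : ∀ ζ : ℂ, ‖ζ‖ < 1 →
      edim (Submodule.span ℂ ((fun g => evalDisk g ζ) '' (M' : Set (hardy E)))) ≤ r) :
    Module.rank ℂ (wandering M) ≤ r := by
  refine rank_le fun s hs => ?_
  rw [← Fintype.card_coe]
  exact card_le_of_linearIndependent_wandering hinv hMM' hr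
    (w := fun i : s => ((i : wandering M) : hardy E)) (fun i => (i : wandering M).2)
    (hs.map' (wandering M).subtype (Submodule.ker_subtype _))

end Wandering

/-! ### Operator-valued functions on finite-dimensional spaces -/

section Operators

variable {D E : Type*}
  [NormedAddCommGroup D] [InnerProductSpace ℂ D] [CompleteSpace D]
  [NormedAddCommGroup E] [InnerProductSpace ℂ E] [CompleteSpace E]

theorem adjoint_comp_self_of_inner_map {T : D →L[ℂ] E} (hT : ∀ x y, ⟪T x, T y⟫_ℂ = ⟪x, y⟫_ℂ) :
    (ContinuousLinearMap.adjoint T).comp T = ContinuousLinearMap.id ℂ D := by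
  refine ContinuousLinearMap.ext fun y => ext_inner_left ℂ fun x => ?_
  rw [ContinuousLinearMap.comp_apply, ContinuousLinearMap.adjoint_inner_right, hT,
    ContinuousLinearMap.id_apply]

theorem inner_map_of_adjoint_comp_self {T : D →L[ℂ] E}
    (hT : (ContinuousLinearMap.adjoint T).comp T = ContinuousLinearMap.id ℂ D) (x y : D) :
    ⟪T x, T y⟫_ℂ = ⟪x, y⟫_ℂ := by
  rw [← ContinuousLinearMap.adjoint_inner_right, ← ContinuousLinearMap.comp_apply, hT,
    ContinuousLinearMap.id_apply]

theorem comp_adjoint_self_of_surjective {T : D →L[ℂ] E}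
    (hT : (ContinuousLinearMap.adjoint T).comp T = ContinuousLinearMap.id ℂ D)
    (hs : Function.Surjective T) :
    T.comp (ContinuousLinearMap.adjoint T) = ContinuousLinearMap.id ℂ E := by
  refine ContinuousLinearMap.ext fun y => ?_
  obtain ⟨x, rfl⟩ := hs y
  have := DFunLike.congr_fun hT x
  rw [ContinuousLinearMap.comp_apply, ContinuousLinearMap.id_apply] at this
  rw [ContinuousLinearMap.comp_apply, this, ContinuousLinearMap.id_apply]

theorem injective_of_adjoint_comp_self {T : D →L[ℂ] E}
    (hT : (ContinuousLinearMap.adjoint T).comp T = ContinuousLinearMap.id ℂ D) :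
    Function.Injective T := fun x y h => by
  have hx := DFunLike.congr_fun hT x
  have hy := DFunLike.congr_fun hT y
  rw [ContinuousLinearMap.comp_apply, ContinuousLinearMap.id_apply] at hx hy
  rw [← hx, ← hy, h]

theorem ae_eq_of_forall_apply [FiniteDimensional ℂ D] {S T : UnitAddCircle → D →L[ℂ] E}
    (h : ∀ x, ∀ᵐ t ∂(haarAddCircle (T := (1 : ℝ))), S t x = T t x) :
    ∀ᵐ t ∂(haarAddCircle (T := (1 : ℝ))), S t = T t := by
  have h' : ∀ᵐ t ∂(haarAddCircle (T := (1 : ℝ))), ∀ i,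
      S t (Module.finBasis ℂ D i) = T t (Module.finBasis ℂ D i) := ae_all_iff.2 fun i => h _
  filter_upwards [h'] with t ht
  refine ContinuousLinearMap.coe_injective ((Module.finBasis ℂ D).ext ht)

/-- Taking adjoints reverses the sign of the index and `t ↦ -t` reverses it again, so `Φ ↦ Φ̃`
preserves analyticity. -/
theorem fourierCoeff_tilde {Θ : UnitAddCircle → D →L[ℂ] E} {y : E}
    (hy : Integrable (fun t => tilde Θ t y) (haarAddCircle (T := (1 : ℝ)))) {n : ℤ}
    (hΘ : ∀ x, fourierCoeff (fun t => ⟪y, Θ t x⟫_ℂ) n = 0) :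
    fourierCoeff (fun t => tilde Θ t y) n = 0 := by
  refine ext_inner_left ℂ fun x => ?_
  rw [inner_fourierCoeff hy, inner_zero_right]
  simp only [tilde, ContinuousLinearMap.adjoint_inner_right]
  rw [fourierCoeff_comp_neg (fun t => ⟪Θ t x, y⟫_ℂ), fourierCoeff_inner_swap, neg_neg, hΘ, map_zero]

theorem IsInner.strongL2 {Θ : UnitAddCircle → D →L[ℂ] E} (hΘ : IsInner Θ) : StrongL2 Θ := by
  intro x
  refine (memLp_const (μ := haarAddCircle (T := (1 : ℝ))) (p := 2) x).of_le (hΘ.1.1 x) ?_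
  filter_upwards [hΘ.inner_map] with t ht
  exact (norm_map_of_inner_map ht x).le

theorem StrongL2.integrable {Θ : UnitAddCircle → D →L[ℂ] E} (hΘ : StrongL2 Θ) (x : D) :
    Integrable (fun t => Θ t x) (haarAddCircle (T := (1 : ℝ))) :=
  (hΘ x).integrable (by norm_num)

theorem IsInner.strongH2_tilde [FiniteDimensional ℂ D] {Θ : UnitAddCircle → D →L[ℂ] E}
    (hΘ : IsInner Θ) : StrongH2 (tilde Θ) := by
  have hL2 : StrongL2 (tilde Θ) := by
    intro y
    have h := hΘ.memLp_adjoint_apply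
      (memLp_const (μ := haarAddCircle (T := (1 : ℝ))) (p := 2) y)
    have h' := memLp_comp_neg h
    exact h'
  refine ⟨hL2, fun y n hn => fourierCoeff_tilde (hL2.integrable y) fun x => ?_⟩
  rw [← inner_fourierCoeff (hΘ.strongL2.integrable x), hΘ.1.2.2 x n hn, inner_zero_right]

/-- If `Θ` is a two-sided inner function on finite-dimensional spaces, then so is `Θ̃`. -/
theorem isInner_tilde [FiniteDimensional ℂ D] {Θ : UnitAddCircle → D →L[ℂ] E} (hΘ : IsInner Θ)
    (hs : ∀ᵐ t ∂(haarAddCircle (T := (1 : ℝ))), Function.Surjective (Θ t)) :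
    IsInner (tilde Θ) := by
  have hco : ∀ᵐ t ∂(haarAddCircle (T := (1 : ℝ))),
      (Θ t).comp (ContinuousLinearMap.adjoint (Θ t)) = ContinuousLinearMap.id ℂ E := by
    filter_upwards [hΘ.2, hs] with t h1 h2
    exact comp_adjoint_self_of_surjective h1 h2
  have hin : ∀ᵐ t ∂(haarAddCircle (T := (1 : ℝ))), (ContinuousLinearMap.adjoint
      (tilde Θ t)).comp (tilde Θ t) = ContinuousLinearMap.id ℂ E := by
    filter_upwards [ae_comp_neg hco] with t ht
    rw [tilde, ContinuousLinearMap.adjoint_adjoint, ht]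
  refine ⟨⟨fun y => (hΘ.strongH2_tilde.1 y).1, ⟨1, ?_⟩, hΘ.strongH2_tilde.2⟩, hin⟩
  filter_upwards [hin] with t ht
  refine ContinuousLinearMap.opNorm_le_bound _ zero_le_one fun x => ?_
  rw [one_mul, norm_map_of_inner_map (inner_map_of_adjoint_comp_self ht)]

/-- The function with values in `B(ℂⁿ, E)` whose columns are given functions in `H²_E`. -/
def ofColumns {n : ℕ} (w : Fin n → hardy E) (t : UnitAddCircle) :
    EuclideanSpace ℂ (Fin n) →L[ℂ] E :=
  ∑ i, (EuclideanSpace.proj i : EuclideanSpace ℂ (Fin n) →L[ℂ] ℂ).smulRight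
    (((w i : L2 E) : UnitAddCircle → E) t)

theorem ofColumns_apply {n : ℕ} (w : Fin n → hardy E) (t : UnitAddCircle)
    (x : EuclideanSpace ℂ (Fin n)) :
    ofColumns w t x = ∑ i, x i • ((w i : L2 E) : UnitAddCircle → E) t := by
  simp [ofColumns]

theorem coeFn_sum_smul {n : ℕ} (w : Fin n → hardy E) (c : Fin n → ℂ) (s : Finset (Fin n)) :
    (((∑ i ∈ s, c i • w i : hardy E) : L2 E) : UnitAddCircle → E)
      =ᵐ[haarAddCircle (T := (1 : ℝ))]
      fun t => ∑ i ∈ s, c i • ((w i : L2 E) : UnitAddCircle → E) t := by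
  induction s using Finset.induction_on with
  | empty =>
    filter_upwards [Lp.coeFn_zero E 2 (haarAddCircle (T := (1 : ℝ)))] with t ht
    rw [Finset.sum_empty, Finset.sum_empty, Submodule.coe_zero, ht, Pi.zero_apply]
  | insert a s ha ih =>
    rw [Finset.sum_insert ha, Submodule.coe_add, Submodule.coe_smul]
    filter_upwards [ih, Lp.coeFn_add (c a • (w a : L2 E)) ((∑ i ∈ s, c i • w i : hardy E) : L2 E),
      Lp.coeFn_smul (c a) (w a : L2 E)] with t h1 h2 h3
    rw [h2, Pi.add_apply, h1, h3, Pi.smul_apply, Finset.sum_insert ha]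

theorem coeFn_ofColumns {n : ℕ} (w : Fin n → hardy E) (x : EuclideanSpace ℂ (Fin n)) :
    (((∑ i, x i • w i : hardy E) : L2 E) : UnitAddCircle → E)
      =ᵐ[haarAddCircle (T := (1 : ℝ))] fun t => ofColumns w t x := by
  filter_upwards [coeFn_sum_smul w (fun i => x i) Finset.univ] with t ht
  rw [ht, ofColumns_apply]

theorem isInner_ofColumns {n : ℕ} {w : Fin n → hardy E}
    (hw : ∀ i j, ∀ᵐ t ∂(haarAddCircle (T := (1 : ℝ))),
      ⟪((w i : L2 E) : UnitAddCircle → E) t, ((w j : L2 E) : UnitAddCircle → E) t⟫_ℂ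
        = if i = j then 1 else 0) : IsInner (ofColumns w) := by
  have hw' : ∀ᵐ t ∂(haarAddCircle (T := (1 : ℝ))), ∀ i j,
      ⟪((w i : L2 E) : UnitAddCircle → E) t, ((w j : L2 E) : UnitAddCircle → E) t⟫_ℂ
        = if i = j then 1 else 0 := ae_all_iff.2 fun i => ae_all_iff.2 fun j => hw i j
  have hin : ∀ᵐ t ∂(haarAddCircle (T := (1 : ℝ))), ∀ x y,
      ⟪ofColumns w t x, ofColumns w t y⟫_ℂ = ⟪x, y⟫_ℂ := by
    filter_upwards [hw'] with t ht x y
    simp only [ofColumns_apply, sum_inner, inner_sum, inner_smul_left, inner_smul_right, ht,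
      PiLp.inner_apply]
    refine Finset.sum_congr rfl fun i _ => ?_
    simp [mul_comm]
  refine ⟨⟨fun x => ?_, ⟨1, ?_⟩, fun x k hk => ?_⟩, ?_⟩
  · exact (Lp.aestronglyMeasurable _).congr (coeFn_ofColumns w x)
  · filter_upwards [hin] with t ht
    refine ContinuousLinearMap.opNorm_le_bound _ zero_le_one fun x => ?_
    rw [one_mul, norm_map_of_inner_map ht]
  · rw [← fourierCoeff_congr (coeFn_ofColumns w x)]
    exact (∑ i, x i • w i : hardy E).2 k hk
  · filter_upwards [hin] with t ht
    exact adjoint_comp_self_of_inner_map ht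

theorem rangeH2_le_of_const [FiniteDimensional ℂ D] {Θ : UnitAddCircle → D →L[ℂ] E}
    (hΘ : IsInner Θ) {M : Submodule ℂ (hardy E)} (hM : IsClosed (M : Set (hardy E)))
    (hinv : ∀ g ∈ M, shift E g ∈ M) (hc : ∀ x, mulHardy hΘ (constHardy x) ∈ M) :
    rangeH2 Θ ≤ M := by
  rw [rangeH2_eq_range hΘ]
  rintro _ ⟨f, rfl⟩
  let p : Submodule ℂ (hardy D) := M.comap (mulHardy hΘ).toLinearMap
  have hp : IsClosed (p : Set (hardy D)) := hM.preimage (mulHardy hΘ).continuous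
  have hle : Submodule.span ℂ {g : hardy D | ∃ (n : ℕ) (x : D),
      g = (shift D ^ n) (constHardy x)} ≤ p := by
    rw [Submodule.span_le]
    rintro _ ⟨n, x, rfl⟩
    change mulHardy hΘ ((shift D ^ n) (constHardy x)) ∈ M
    rw [mulHardy_shift_pow]
    exact shift_pow_mem hinv (hc x) n
  have := Submodule.topologicalClosure_minimal _ hle hp
  rw [closure_span_monomials] at this
  exact this Submodule.mem_top

/-! ### The invariant subspace attached to a strong `L²`-function. -/

theorem inner_backwardShift_pow_projection (g : hardy E) {f : UnitAddCircle → E}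
    (hf : MemLp f 2 (haarAddCircle (T := (1 : ℝ)))) (n : ℕ) :
    ⟪g, (backwardShift E ^ n) ((hardy E).orthogonalProjectionOnto (hf.toLp _))⟫_ℂ
      = fourierCoeff (fun t => ⟪((g : L2 E) : UnitAddCircle → E) t, f t⟫_ℂ) n := by
  rw [inner_backwardShift_pow, Submodule.inner_orthogonalProjectionOnto_eq_of_mem_left,
    inner_shift_pow]
  refine fourierCoeff_congr ?_ n
  filter_upwards [hf.coeFn_toLp] with t ht
  rw [ht]

/-- The functions `g ∈ H²_E` for which `⟪g, Φ d⟫` has no Fourier coefficient of positive index. -/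
def coanalyticAnnihilator {Φ : UnitAddCircle → D →L[ℂ] E} (hΦ : StrongL2 Φ) :
    Submodule ℂ (hardy E) :=
  (Submodule.span ℂ {u : hardy E | ∃ (n : ℕ) (d : D),
    u = (backwardShift E ^ (n + 1)) ((hardy E).orthogonalProjectionOnto ((hΦ d).toLp _))})ᗮ

/-- The exponent `n + 1` in the definition leaves the coefficient of index 0 free, in agreement with
the constant term that `A^*` may have. -/
theorem mem_coanalyticAnnihilator {Φ : UnitAddCircle → D →L[ℂ] E} (hΦ : StrongL2 Φ)
    {g : hardy E} : g ∈ coanalyticAnnihilator hΦ ↔ ∀ (d : D) (k : ℤ), 0 < k →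
      fourierCoeff (fun t => ⟪((g : L2 E) : UnitAddCircle → E) t, Φ t d⟫_ℂ) k = 0 := by
  constructor
  · intro hg d k hk
    obtain ⟨n, rfl⟩ : ∃ n : ℕ, k = ((n + 1 : ℕ) : ℤ) := ⟨(k - 1).toNat, by omega⟩
    rw [← inner_backwardShift_pow_projection g (hΦ d)]
    exact (Submodule.mem_orthogonal' _ _).1 hg _ (Submodule.subset_span ⟨n, d, rfl⟩)
  · intro h
    rw [coanalyticAnnihilator, Submodule.mem_orthogonal']
    intro u hu
    induction hu using Submodule.span_induction with
    | mem u hu =>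
      obtain ⟨n, d, rfl⟩ := hu
      rw [inner_backwardShift_pow_projection g (hΦ d)]
      exact h d _ (by positivity)
    | zero => exact inner_zero_right _
    | add u v _ _ hu hv => rw [inner_add_right, hu, hv, add_zero]
    | smul c u _ hu => rw [inner_smul_right, hu, mul_zero]

theorem isClosed_coanalyticAnnihilator {Φ : UnitAddCircle → D →L[ℂ] E} (hΦ : StrongL2 Φ) :
    IsClosed (coanalyticAnnihilator hΦ : Set (hardy E)) :=
  Submodule.isClosed_orthogonal _

theorem fourierCoeff_inner_shift (g : hardy E) (f : UnitAddCircle → E) (k : ℤ) :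
    fourierCoeff (fun t => ⟪((shift E g : L2 E) : UnitAddCircle → E) t, f t⟫_ℂ) k
      = fourierCoeff (fun t => ⟪((g : L2 E) : UnitAddCircle → E) t, f t⟫_ℂ) (k + 1) := by
  have h : (fun t => ⟪((shift E g : L2 E) : UnitAddCircle → E) t, f t⟫_ℂ)
      =ᵐ[haarAddCircle (T := (1 : ℝ))] fun t => fourier (-1) t •
        ⟪((g : L2 E) : UnitAddCircle → E) t, f t⟫_ℂ := by
    filter_upwards [coeFn_mulZ (g : L2 E)] with t ht
    rw [coe_shift, ht, inner_smul_left, fourier_neg, smul_eq_mul]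
  rw [fourierCoeff_congr_ae h, fourierCoeff_fourier_smul, sub_neg_eq_add]

theorem shift_mem_coanalyticAnnihilator {Φ : UnitAddCircle → D →L[ℂ] E} (hΦ : StrongL2 Φ) :
    ∀ g ∈ coanalyticAnnihilator hΦ, shift E g ∈ coanalyticAnnihilator hΦ := by
  intro g hg
  rw [mem_coanalyticAnnihilator] at hg ⊢
  intro d k hk
  rw [fourierCoeff_inner_shift]
  exact hg d _ (by omega)

theorem mem_orthogonal_cyclicSpan {F : Set (hardy E)} {g : hardy E} :
    g ∈ (cyclicSpan F)ᗮ ↔ ∀ (n : ℕ), ∀ f ∈ F, ⟪g, (backwardShift E ^ n) f⟫_ℂ = 0 := by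
  rw [cyclicSpan, Submodule.orthogonal_closure, Submodule.mem_orthogonal']
  constructor
  · intro h n f hf
    exact h _ (Submodule.subset_span (Set.mem_iUnion.2 ⟨n, f, hf, rfl⟩))
  · intro h u hu
    induction hu using Submodule.span_induction with
    | mem u hu =>
      obtain ⟨n, f, hf, rfl⟩ := Set.mem_iUnion.1 hu
      exact h n f hf
    | zero => exact inner_zero_right _
    | add u v _ _ hu hv => rw [inner_add_right, hu, hv, add_zero]
    | smul c u _ hu => rw [inner_smul_right, hu, mul_zero]

/-- The factor `z` makes up for the free coefficient of index 0. Through this inclusion the degree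
of non-cyclicity controls the annihilator. -/
theorem shift_mem_orthogonal_cyclicSpan {ι : Type*} (d : HilbertBasis ι ℂ D)
    {Φ : UnitAddCircle → D →L[ℂ] E} (hΦ : StrongL2 Φ) {g : hardy E}
    (hg : g ∈ coanalyticAnnihilator hΦ) :
    shift E g ∈ (cyclicSpan (analyticColumns d hΦ))ᗮ := by
  rw [mem_orthogonal_cyclicSpan]
  rintro n _ ⟨i, rfl⟩
  rw [inner_backwardShift_pow_projection _ (hΦ (d i)), fourierCoeff_inner_shift]
  exact (mem_coanalyticAnnihilator hΦ).1 hg (d i) _ (by positivity)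

end Operators

/-! ### Canonical decompositions generate the model space -/

section CyclicSubspaces

variable {H : Type*} [NormedAddCommGroup H] [InnerProductSpace ℂ H]

theorem coe_pow_of_forall_coe {p : Submodule ℂ H} {T : H →L[ℂ] H} {S : p →L[ℂ] p}
    (hS : ∀ f, (S f : H) = T f) (n : ℕ) (f : p) : ((S ^ n) f : H) = (T ^ n) (f : H) := by
  induction n with
  | zero => rfl
  | succ n ih => rw [pow_succ', pow_succ', mul_apply_eq_comp, mul_apply_eq_comp, hS, ih]

theorem closure_iSup_map_pow_eq_top_iff [CompleteSpace H] (T : H →L[ℂ] H) (F : Submodule ℂ H) :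
    (⨆ n : ℕ, F.map ((T ^ n : H →L[ℂ] H) : H →ₗ[ℂ] H)).topologicalClosure = ⊤ ↔
      ∀ g, (∀ n : ℕ, ∀ f ∈ F, ⟪(T ^ n) f, g⟫_ℂ = 0) → g = 0 := by
  rw [Submodule.topologicalClosure_eq_top_iff, Submodule.eq_bot_iff]
  refine forall_congr' fun g => imp_congr_left ?_
  rw [← Submodule.iInf_orthogonal, Submodule.mem_iInf]
  refine forall_congr' fun n => ?_
  rw [Submodule.mem_orthogonal]
  constructor
  · exact fun h f hf => h _ ⟨f, hf, rfl⟩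
  · rintro h _ ⟨f, hf, rfl⟩
    exact h f hf

theorem spectralMultiplicity_le_edim [CompleteSpace H] {p : Submodule ℂ H} [CompleteSpace p]
    {T : H →L[ℂ] H} {S : p →L[ℂ] p} (hS : ∀ f, (S f : H) = T f) {V : Type*} [AddCommGroup V]
    [Module ℂ V] (P : V →ₗ[ℂ] H) (hP : ∀ v, P v ∈ p)
    (hcyc : ∀ g ∈ p, (∀ (n : ℕ) (v : V), ⟪g, (T ^ n) (P v)⟫_ℂ = 0) → g = 0) :
    spectralMultiplicity S ≤ edim V := by
  let Q : V →ₗ[ℂ] p := P.codRestrict _ hP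
  have hQ : (⨆ n : ℕ, Q.range.map ((S ^ n : p →L[ℂ] p) : p →ₗ[ℂ] p)).topologicalClosure = ⊤ := by
    rw [closure_iSup_map_pow_eq_top_iff]
    refine fun g hg => Subtype.ext (hcyc g g.2 fun n v => ?_)
    have h1 := hg n (Q v) ⟨v, rfl⟩
    rw [Submodule.coe_inner, coe_pow_of_forall_coe hS, inner_eq_zero_symm] at h1
    exact h1
  exact le_trans (iInf₂_le Q.range hQ) (edim_range_le Q)

end CyclicSubspaces

section ModelSpace

variable {E E' : Type*}
  [NormedAddCommGroup E] [InnerProductSpace ℂ E] [CompleteSpace E]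
  [NormedAddCommGroup E'] [InnerProductSpace ℂ E'] [CompleteSpace E']

instance (Δ : UnitAddCircle → E' →L[ℂ] E) : CompleteSpace (modelSpace Δ) :=
  (Submodule.isClosed_orthogonal _).completeSpace_coe

theorem coe_modelOperator (Δ : UnitAddCircle → E' →L[ℂ] E) (f : modelSpace Δ) :
    (modelOperator Δ f : hardy E) = backwardShift E (f : hardy E) := rfl

end ModelSpace

/-! ### The annihilator of a canonical decomposition is `Δ H²`. -/

section Generation

variable {D E E' : Type*}
  [NormedAddCommGroup D] [InnerProductSpace ℂ D] [CompleteSpace D]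
  [NormedAddCommGroup E] [InnerProductSpace ℂ E] [CompleteSpace E]
  [NormedAddCommGroup E'] [InnerProductSpace ℂ E'] [CompleteSpace E'] [FiniteDimensional ℂ E']
  {Φ : UnitAddCircle → D →L[ℂ] E} {Δ : UnitAddCircle → E' →L[ℂ] E}
  {A : UnitAddCircle → E' →L[ℂ] D} {B : UnitAddCircle → D →L[ℂ] E}

theorem IsCanonicalDecomposition.adjoint_comp_eq (h : IsCanonicalDecomposition Φ Δ A B) :
    ∀ᵐ t ∂(haarAddCircle (T := (1 : ℝ))),
      (ContinuousLinearMap.adjoint (Δ t)).comp (Φ t) = ContinuousLinearMap.adjoint (A t) := by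
  filter_upwards [h.eq_add, h.adjoint_comp, h.isInner.2] with t h1 h2 h3
  rw [h1, ContinuousLinearMap.comp_add, h2, add_zero, ← ContinuousLinearMap.comp_assoc, h3,
    ContinuousLinearMap.id_comp]

/-- `⟪Δ x, Φ d⟫ = ⟪x, A^* d⟫`, and `A^*` is coanalytic since `Ã` is analytic. -/
theorem IsCanonicalDecomposition.const_mem (h : IsCanonicalDecomposition Φ Δ A B) (x : E') :
    mulHardy h.isInner (constHardy x) ∈ coanalyticAnnihilator h.strongL2 := by
  rw [mem_coanalyticAnnihilator]
  intro d k hk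
  have heq : (fun t => ⟪((mulHardy h.isInner (constHardy x) : L2 E) : UnitAddCircle → E) t,
      Φ t d⟫_ℂ) =ᵐ[haarAddCircle (T := (1 : ℝ))] fun t => ⟪x, tilde A (-t) d⟫_ℂ := by
    filter_upwards [coeFn_mulHardy_const h.isInner x, h.adjoint_comp_eq] with t h1 h2
    rw [h1, tilde, neg_neg, ← h2, ContinuousLinearMap.comp_apply,
      ContinuousLinearMap.adjoint_inner_right]
  rw [fourierCoeff_congr_ae heq, fourierCoeff_comp_neg (fun t => ⟪x, tilde A t d⟫_ℂ),
    ← inner_fourierCoeff (h.strongH2_tilde.1.integrable d), h.strongH2_tilde.2 d _ (by omega),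
    inner_zero_right]

theorem IsCanonicalDecomposition.rangeH2_le (h : IsCanonicalDecomposition Φ Δ A B) :
    rangeH2 Δ ≤ coanalyticAnnihilator h.strongL2 :=
  rangeH2_le_of_const h.isInner (isClosed_coanalyticAnnihilator _)
    (shift_mem_coanalyticAnnihilator _) h.const_mem

variable [TopologicalSpace.SeparableSpace E]

theorem IsCanonicalDecomposition.rank_wandering_le (h : IsCanonicalDecomposition Φ Δ A B) {ι : Type}
    (b : HilbertBasis ι ℂ D) :
    Module.rank ℂ (wandering (coanalyticAnnihilator h.strongL2)) ≤ Module.finrank ℂ E' := by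
  refine Beurling.rank_wandering_le (shift_mem_coanalyticAnnihilator _)
    (fun g hg => shift_mem_orthogonal_cyclicSpan b h.strongL2 hg) fun ζ hζ => ?_
  have h1 : edim E' = Module.finrank ℂ E' := by
    rw [edim, ← Module.finrank_eq_rank, Cardinal.toENat_nat]
  rw [← h1]
  exact (le_iSup₂ (f := fun (ζ : ℂ) (_ : ‖ζ‖ < 1) => edim (Submodule.span ℂ
    ((fun g => evalDisk g ζ) '' ((cyclicSpan (analyticColumns b h.strongL2))ᗮ :
      Set (hardy E))))) ζ hζ).trans (h.nc_le ι b)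

/-- If `Θ` is an inner function with `Δ H² ⊆ Θ H² ⊆ M`, where `M` is the annihilator of the
canonical decomposition, and `Θ` is at most as wide as `Δ`, then `Θ = Δ U` for a constant
unitary `U`. -/
theorem IsCanonicalDecomposition.exists_eq_comp (h : IsCanonicalDecomposition Φ Δ A B)
    {K : Type} [NormedAddCommGroup K] [InnerProductSpace ℂ K] [CompleteSpace K]
    [FiniteDimensional ℂ K] {Θ : UnitAddCircle → K →L[ℂ] E} (hΘ : IsInner Θ)
    (hdim : Module.finrank ℂ K ≤ Module.finrank ℂ E')
    (hΔ : ∀ x, mulHardy h.isInner (constHardy x) ∈ rangeH2 Θ)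
    (hM : ∀ x, mulHardy hΘ (constHardy x) ∈ coanalyticAnnihilator h.strongL2) :
    ∃ U : K →L[ℂ] E', ∀ᵐ t ∂(haarAddCircle (T := (1 : ℝ))), Θ t = (Δ t).comp U := by
  -- The only possible quotient in `Δ = Θ C`; its columns are analytic because `Δ x ∈ Θ H²`.
  let C : UnitAddCircle → E' →L[ℂ] K := fun t => (ContinuousLinearMap.adjoint (Θ t)).comp (Δ t)
  have hcol : ∀ x, ∃ c : hardy K, (∀ᵐ t ∂(haarAddCircle (T := (1 : ℝ))),
      C t x = ((c : L2 K) : UnitAddCircle → K) t) ∧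
      ∀ᵐ t ∂(haarAddCircle (T := (1 : ℝ))), Δ t x = Θ t (C t x) := by
    intro x
    obtain ⟨c, hc⟩ := hΔ x
    have hC : ∀ᵐ t ∂(haarAddCircle (T := (1 : ℝ))),
        Δ t x = Θ t (((c : L2 K) : UnitAddCircle → K) t) ∧
        C t x = ((c : L2 K) : UnitAddCircle → K) t := by
      filter_upwards [hc, coeFn_mulHardy_const h.isInner x, hΘ.2] with t h1 h2 h3
      rw [h2] at h1
      refine ⟨h1, ?_⟩
      rw [ContinuousLinearMap.comp_apply, h1, ← ContinuousLinearMap.comp_apply, h3,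
        ContinuousLinearMap.id_apply]
    refine ⟨c, hC.mono fun t ht => ht.2, ?_⟩
    filter_upwards [hC] with t ht
    rw [ht.2, ht.1]
  have hfac : ∀ᵐ t ∂(haarAddCircle (T := (1 : ℝ))), Δ t = (Θ t).comp (C t) :=
    ae_eq_of_forall_apply fun x => (hcol x).choose_spec.2
  have hCiso : ∀ᵐ t ∂(haarAddCircle (T := (1 : ℝ))), ∀ x y, ⟪C t x, C t y⟫_ℂ = ⟪x, y⟫_ℂ := by
    filter_upwards [hfac, hΘ.inner_map, h.isInner.inner_map] with t h1 h2 h3 x y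
    rw [← h2, ← ContinuousLinearMap.comp_apply, ← ContinuousLinearMap.comp_apply, ← h1, h3]
  have hCinner : IsInner C := by
    refine ⟨⟨fun x => ?_, ⟨1, ?_⟩, fun x n hn => ?_⟩, ?_⟩
    · obtain ⟨c, hc, -⟩ := hcol x
      exact (Lp.aestronglyMeasurable _).congr (hc.mono fun t ht => ht.symm)
    · filter_upwards [hCiso] with t ht
      refine ContinuousLinearMap.opNorm_le_bound _ zero_le_one fun x => ?_
      rw [one_mul, norm_map_of_inner_map ht]
    · obtain ⟨c, hc, -⟩ := hcol x
      rw [fourierCoeff_congr_ae hc]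
      exact c.2 n hn
    · filter_upwards [hCiso] with t ht
      exact adjoint_comp_self_of_inner_map ht
  -- An isometry of `E'` into a space of no larger dimension is onto; without this `C̃` need not be
  -- inner.
  have hCsurj : ∀ᵐ t ∂(haarAddCircle (T := (1 : ℝ))), Function.Surjective (C t) := by
    filter_upwards [hCinner.2] with t ht
    have hinj := injective_of_adjoint_comp_self ht
    have hle := LinearMap.finrank_le_finrank_of_injective (f := (C t).toLinearMap) hinj
    exact (LinearMap.injective_iff_surjective_of_finrank_eq_finrank (f := (C t).toLinearMap)
      (le_antisymm hle hdim)).1 hinj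
  have hdivΔ : IsLeftInnerDivisor (tilde C) (tilde Δ) := by
    refine ⟨isInner_tilde hCinner hCsurj, tilde Θ, hΘ.strongH2_tilde, ?_⟩
    filter_upwards [ae_comp_neg hfac] with t ht
    simp only [tilde]
    rw [ht, ContinuousLinearMap.adjoint_comp]
  -- `A^* = Δ^* Φ = C^* (Θ^* Φ)`, and `Θ^* Φ` is coanalytic exactly because the columns of `Θ` lie
  -- in the annihilator.
  have hdivA : IsLeftInnerDivisor (tilde C) (tilde A) := by
    have hL2 : StrongL2 fun t => (tilde Θ t).comp (Φ (-t)) := by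
      intro d
      have h1 := memLp_comp_neg (hΘ.memLp_adjoint_apply (h.strongL2 d))
      exact h1
    refine ⟨isInner_tilde hCinner hCsurj, _, ⟨hL2, fun d n hn => ?_⟩, ?_⟩
    · refine ext_inner_left ℂ fun x => ?_
      rw [inner_fourierCoeff (hL2.integrable d), inner_zero_right]
      simp only [tilde, ContinuousLinearMap.comp_apply, ContinuousLinearMap.adjoint_inner_right]
      rw [fourierCoeff_comp_neg (fun t => ⟪Θ t x, Φ t d⟫_ℂ)]
      rw [← (mem_coanalyticAnnihilator h.strongL2).1 (hM x) d (-n) (by omega)]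
      refine fourierCoeff_congr ?_ _
      filter_upwards [coeFn_mulHardy_const hΘ x] with t ht
      rw [ht]
    · filter_upwards [ae_comp_neg hfac, ae_comp_neg h.adjoint_comp_eq] with t h1 h2
      simp only [tilde]
      rw [← h2, ← ContinuousLinearMap.comp_assoc, ← ContinuousLinearMap.adjoint_comp, ← h1]
  obtain ⟨U, hU⟩ := h.rightCoprime K (tilde C) hdivΔ hdivA
  refine ⟨U.toLinearIsometry.toContinuousLinearMap, ?_⟩
  filter_upwards [hfac, hCinner.2, hCsurj, ae_comp_neg hU] with t h1 h2 h3 h4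
  refine ContinuousLinearMap.ext fun x => ?_
  have h5 := h4 x
  rw [tilde, neg_neg] at h5
  have h6 := DFunLike.congr_fun (comp_adjoint_self_of_surjective h2 h3) x
  rw [ContinuousLinearMap.comp_apply, h5, ContinuousLinearMap.id_apply] at h6
  rw [h1, ContinuousLinearMap.comp_apply, ContinuousLinearMap.comp_apply]
  exact congrArg (Θ t) h6.symm

/-- An orthonormal basis of the wandering subspace gives the columns of an inner `Θ` whose range
contains the annihilator. By coprimality `Θ = Δ U`, so the wandering vectors, and all they generate,
lie in `Δ H²`. -/
theorem IsCanonicalDecomposition.coanalyticAnnihilator_le {D : Type} [NormedAddCommGroup D]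
    [InnerProductSpace ℂ D] [CompleteSpace D]
    {Φ : UnitAddCircle → D →L[ℂ] E} {A : UnitAddCircle → E' →L[ℂ] D}
    {B : UnitAddCircle → D →L[ℂ] E} (h : IsCanonicalDecomposition Φ Δ A B) :
    coanalyticAnnihilator h.strongL2 ≤ rangeH2 Δ := by
  obtain ⟨_, b, -⟩ := exists_hilbertBasis ℂ D
  have hrank := h.rank_wandering_le b
  set M := coanalyticAnnihilator h.strongL2 with hMdef
  have hMcl : IsClosed (M : Set (hardy E)) := isClosed_coanalyticAnnihilator _
  have hMinv : ∀ g ∈ M, shift E g ∈ M := shift_mem_coanalyticAnnihilator _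
  have hfin : Module.Finite ℂ (wandering M) :=
    Module.rank_lt_aleph0_iff.1 (hrank.trans_lt (Cardinal.natCast_lt_aleph0))
  let w := stdOrthonormalBasis ℂ (wandering M)
  have hΘ : IsInner (ofColumns fun i => ((w i : wandering M) : hardy E)) := by
    refine isInner_ofColumns fun i j => ?_
    filter_upwards [inner_ae_eq_of_mem_wandering hMinv (w i).2 (w j).2] with t ht
    rw [ht, ← Submodule.coe_inner, orthonormal_iff_ite.1 w.orthonormal]
  have hconst : ∀ x, mulHardy hΘ (constHardy x) = ∑ i, x i • ((w i : wandering M) : hardy E) := by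
    intro x
    exact Subtype.ext (Lp.ext ((coeFn_mulHardy_const hΘ x).trans
      (coeFn_ofColumns (fun i => ((w i : wandering M) : hardy E)) x).symm))
  have hrepr : ∀ v ∈ wandering M, ∃ x, mulHardy hΘ (constHardy x) = v := by
    intro v hv
    refine ⟨w.repr ⟨v, hv⟩, ?_⟩
    have h1 := congrArg (wandering M).subtype (w.sum_repr ⟨v, hv⟩)
    rw [map_sum] at h1
    rw [hconst]
    exact h1
  have hle : M ≤ rangeH2 (ofColumns fun i => ((w i : wandering M) : hardy E)) := by
    refine le_of_wandering_le hMcl hMinv (isClosed_rangeH2 hΘ)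
      (fun g hg => shift_mem_rangeH2 _ hg) fun v hv => ?_
    obtain ⟨x, rfl⟩ := hrepr v hv
    exact ⟨constHardy x, coeFn_mulHardy hΘ (constHardy x)⟩
  obtain ⟨U, hU⟩ := h.exists_eq_comp hΘ
    (by
      rw [finrank_euclideanSpace_fin]
      exact Module.finrank_le_of_rank_le hrank)
    (fun x => hle (h.const_mem x))
    (fun x => by
      rw [hconst]
      exact Submodule.sum_mem _ fun i _ => Submodule.smul_mem _ _ (w i).2.1)
  refine le_of_wandering_le hMcl hMinv (isClosed_rangeH2 h.isInner)
    (fun g hg => shift_mem_rangeH2 _ hg) fun v hv => ?_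
  obtain ⟨x, rfl⟩ := hrepr v hv
  refine ⟨constHardy (U x), ?_⟩
  filter_upwards [coeFn_mulHardy_const hΘ x, coeFn_constHardy (U x), hU] with t h1 h2 h3
  rw [h1, h2, h3, ContinuousLinearMap.comp_apply]

theorem IsCanonicalDecomposition.spectralMultiplicity_le {D : Type} [NormedAddCommGroup D]
    [InnerProductSpace ℂ D] [CompleteSpace D]
    {Φ : UnitAddCircle → D →L[ℂ] E} {A : UnitAddCircle → E' →L[ℂ] D}
    {B : UnitAddCircle → D →L[ℂ] E} (h : IsCanonicalDecomposition Φ Δ A B) :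
    spectralMultiplicity (modelOperator Δ) ≤ edim D := by
  -- The extra backward shift matters: `P₊(Φ d)` itself need not lie in the model space, as index 0
  -- is unconstrained.
  let P : D →ₗ[ℂ] hardy E :=
    { toFun := fun d => backwardShift E ((hardy E).orthogonalProjectionOnto ((h.strongL2 d).toLp _))
      map_add' := fun d e => by
        rw [← map_add, ← map_add, ← MemLp.toLp_add]
        congr 2
        refine (MemLp.toLp_eq_toLp_iff _ _).2 (Eventually.of_forall fun t => ?_)
        simp
      map_smul' := fun c d => by
        rw [RingHom.id_apply, ← map_smul, ← map_smul, ← MemLp.toLp_const_smul]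
        congr 2
        refine (MemLp.toLp_eq_toLp_iff _ _).2 (Eventually.of_forall fun t => ?_)
        simp }
  have hP : ∀ (g : hardy E) (n : ℕ) (d : D), ⟪g, (backwardShift E ^ n) (P d)⟫_ℂ
      = fourierCoeff (fun t => ⟪((g : L2 E) : UnitAddCircle → E) t, Φ t d⟫_ℂ)
        ((n + 1 : ℕ) : ℤ) := fun g n d => by
    rw [← inner_backwardShift_pow_projection g (h.strongL2 d), pow_succ, mul_apply_eq_comp]
    rfl
  have hmem : ∀ d, P d ∈ modelSpace Δ := fun d g hg => by
    have h1 := (mem_coanalyticAnnihilator h.strongL2).1 (h.rangeH2_le hg) d 1 one_pos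
    have h2 := hP g 0 d
    rw [pow_zero, one_apply_eq_self] at h2
    rw [h2]
    exact h1
  refine spectralMultiplicity_le_edim (coe_modelOperator Δ) P hmem fun g hg hcyc => ?_
  have hgM : g ∈ coanalyticAnnihilator h.strongL2 := by
    rw [mem_coanalyticAnnihilator]
    intro d k hk
    obtain ⟨n, rfl⟩ : ∃ n : ℕ, k = ((n + 1 : ℕ) : ℤ) := ⟨(k - 1).toNat, by omega⟩
    rw [← hP]
    exact hcyc n d
  exact inner_self_eq_zero.1 (hg _ (h.coanalyticAnnihilator_le hgM))

end Generation

/-! ### Canonical decompositions from generators of the model space -/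

section Construction

variable {E E' : Type*}
  [NormedAddCommGroup E] [InnerProductSpace ℂ E] [CompleteSpace E]
  [NormedAddCommGroup E'] [InnerProductSpace ℂ E'] [CompleteSpace E'] [FiniteDimensional ℂ E']
  {Δ : UnitAddCircle → E' →L[ℂ] E} {n : ℕ} {f : Fin n → hardy E}

theorem strongL2_ofColumns (w : Fin n → hardy E) : StrongL2 (ofColumns w) := fun x =>
  (memLp_congr_ae (coeFn_ofColumns w x)).1 (Lp.memLp _)

theorem fourierCoeff_inner_ofColumns_shift (g : UnitAddCircle → E) (x : EuclideanSpace ℂ (Fin n))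
    (k : ℤ) :
    fourierCoeff (fun t => ⟪g t, ofColumns (fun i => shift E (f i)) t x⟫_ℂ) k
      = fourierCoeff (fun t => ⟪g t,
        (((∑ i, x i • f i : hardy E) : L2 E) : UnitAddCircle → E) t⟫_ℂ) (k - 1) := by
  rw [← fourierCoeff_fourier_smul]
  refine congrFun (fourierCoeff_congr_ae ?_) k
  have hsum : (∑ i, x i • shift E (f i)) = shift E (∑ i, x i • f i) := by
    simp only [map_sum, map_smul]
  have h1 := coeFn_ofColumns (fun i => shift E (f i)) x
  rw [hsum, coe_shift] at h1
  filter_upwards [h1, coeFn_mulZ ((∑ i, x i • f i : hardy E) : L2 E)] with t h2 h3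
  rw [← h2, h3, inner_smul_right, smul_eq_mul]

theorem fourierCoeff_inner_ofColumns_single (g : UnitAddCircle → E) (i : Fin n) (k : ℤ) :
    fourierCoeff (fun t => ⟪g t, ofColumns (fun i => shift E (f i)) t
      (EuclideanSpace.single i 1)⟫_ℂ) k
      = fourierCoeff (fun t => ⟪g t, ((f i : L2 E) : UnitAddCircle → E) t⟫_ℂ) (k - 1) := by
  rw [fourierCoeff_inner_ofColumns_shift]
  congr 1
  funext t
  congr
  simp [PiLp.single_apply, ite_smul]

theorem fourierCoeff_inner_rangeH2_ofColumns (hf : ∀ i, f i ∈ modelSpace Δ) {g : hardy E}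
    (hg : g ∈ rangeH2 Δ) (x : EuclideanSpace ℂ (Fin n)) {k : ℤ} (hk : 0 < k) :
    fourierCoeff (fun t => ⟪((g : L2 E) : UnitAddCircle → E) t,
      ofColumns (fun i => shift E (f i)) t x⟫_ℂ) k = 0 := by
  rw [fourierCoeff_inner_ofColumns_shift]
  obtain ⟨m, hm⟩ : ∃ m : ℕ, k - 1 = m := ⟨(k - 1).toNat, by omega⟩
  rw [hm, ← inner_shift_pow, ← Submodule.coe_inner]
  exact (modelSpace Δ).sum_mem (fun i _ => (modelSpace Δ).smul_mem _ (hf i)) _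
    (shift_pow_mem (fun g hg => shift_mem_rangeH2 Δ hg) hg m)

/-- Since `fᵢ ⊥ Δ H²`, the coefficients of `Δ^* fᵢ` of index `≥ 0` vanish; multiplication by `z`
moves this to index `≥ 1`, so `Δ^* (z fᵢ)` is still coanalytic. -/
theorem strongH2_adjoint_comp_ofColumns (hΔ : IsInner Δ) (hf : ∀ i, f i ∈ modelSpace Δ) :
    StrongH2 fun t => (tilde Δ t).comp (ofColumns (fun i => shift E (f i)) (-t)) := by
  have hL2 : StrongL2 fun t => (tilde Δ t).comp (ofColumns (fun i => shift E (f i)) (-t)) := by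
    intro d
    have h1 := memLp_comp_neg (hΔ.memLp_adjoint_apply
      (strongL2_ofColumns (fun i => shift E (f i)) d))
    exact h1
  refine ⟨hL2, fun d k hk => ext_inner_left ℂ fun x => ?_⟩
  rw [inner_fourierCoeff (hL2.integrable d), inner_zero_right]
  simp only [tilde, ContinuousLinearMap.comp_apply, ContinuousLinearMap.adjoint_inner_right]
  rw [fourierCoeff_comp_neg (fun t => ⟪Δ t x, ofColumns (fun i => shift E (f i)) t d⟫_ℂ)]
  have hmem : mulHardy hΔ (constHardy x) ∈ rangeH2 Δ := ⟨_, coeFn_mulHardy hΔ _⟩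
  rw [← fourierCoeff_inner_rangeH2_ofColumns hf hmem d (k := -k) (by omega)]
  refine fourierCoeff_congr ?_ _
  filter_upwards [coeFn_mulHardy_const hΔ x] with t ht
  rw [ht]

theorem orthogonal_cyclicSpan_le_rangeH2
    (hgen : ∀ g : hardy E, (∀ (m : ℕ) i, ⟪(shift E ^ m) g, f i⟫_ℂ = 0) → g ∈ rangeH2 Δ)
    {ι : Type*} (b : HilbertBasis ι ℂ (EuclideanSpace ℂ (Fin n)))
    (hΦ : StrongL2 (ofColumns fun i => shift E (f i))) :
    (cyclicSpan (analyticColumns b hΦ))ᗮ ≤ rangeH2 Δ := by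
  intro g hg
  rw [mem_orthogonal_cyclicSpan] at hg
  refine hgen g fun m i => ?_
  let L : EuclideanSpace ℂ (Fin n) →L[ℂ] ℂ := ∑ j, ⟪(shift E ^ m) g, f j⟫_ℂ • EuclideanSpace.proj j
  -- The columns are `z fᵢ`, so the coefficient of index `m + 1` tests `zᵐ g` against `fᵢ`.
  have hL : ∀ x, L x = fourierCoeff (fun t => ⟪((g : L2 E) : UnitAddCircle → E) t,
      ofColumns (fun i => shift E (f i)) t x⟫_ℂ) ((m + 1 : ℕ) : ℤ) := by
    intro x
    rw [fourierCoeff_inner_ofColumns_shift]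
    have hm : ((m + 1 : ℕ) : ℤ) - 1 = m := by omega
    rw [hm, ← inner_shift_pow, ← Submodule.coe_inner, inner_sum]
    simp [L, inner_smul_right, mul_comm]
  have hL0 : L = 0 := by
    refine ContinuousLinearMap.ext_on
      (Submodule.dense_iff_topologicalClosure_eq_top.2 b.dense_span) ?_
    rintro _ ⟨j, rfl⟩
    rw [hL, ← inner_backwardShift_pow_projection g (hΦ (b j))]
    exact hg _ _ ⟨j, rfl⟩
  have h1 := DFunLike.congr_fun hL0 (EuclideanSpace.single i 1)
  simpa [L, PiLp.single_apply] using h1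

variable [TopologicalSpace.SeparableSpace E]

/-- If the backward shift orbits of `f` generate the model space of `Δ`, then `Δ` and the
function `A` with `A^* = Δ^* (z f)` are right coprime. -/
theorem rightCoprime_of_generators (hΔ : IsInner Δ)
    (hgen : ∀ g : hardy E, (∀ (m : ℕ) i, ⟪(shift E ^ m) g, f i⟫_ℂ = 0) → g ∈ rangeH2 Δ) :
    RightCoprime Δ fun t => (ContinuousLinearMap.adjoint
      (ofColumns (fun i => shift E (f i)) t)).comp (Δ t) := by
  intro D' _ _ _ _ Ω hdivΔ hdivA
  obtain ⟨hΩ, C, hC, hfacΔ⟩ := hdivΔ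
  obtain ⟨-, G, hG, hfacA⟩ := hdivA
  have hfin : FiniteDimensional ℂ D' := by
    obtain ⟨t, ht⟩ := hΩ.2.exists
    exact Module.Finite.of_injective (Ω t).toLinearMap (injective_of_adjoint_comp_self ht)
  -- `Δ̃ = Ω C` is pointwise onto because `Δ^* Δ = I`.
  have hsurj : ∀ᵐ t ∂(haarAddCircle (T := (1 : ℝ))), Function.Surjective (Ω t) := by
    filter_upwards [hfacΔ, ae_comp_neg hΔ.2] with t h1 h2 y
    refine ⟨C t (Δ (-t) y), ?_⟩
    rw [← ContinuousLinearMap.comp_apply, ← h1, tilde, ← ContinuousLinearMap.comp_apply, h2,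
      ContinuousLinearMap.id_apply]
  have hΔC : ∀ᵐ t ∂(haarAddCircle (T := (1 : ℝ))), ∀ x, Δ t (Ω (-t) x) = tilde C t x := by
    filter_upwards [ae_comp_neg hfacΔ, ae_comp_neg hΩ.2] with t h1 h2 x
    have h3 : Δ t = (tilde C t).comp (ContinuousLinearMap.adjoint (Ω (-t))) := by
      rw [tilde, ← ContinuousLinearMap.adjoint_comp, ← h1, tilde, neg_neg,
        ContinuousLinearMap.adjoint_adjoint]
    have h4 := DFunLike.congr_fun h2 x
    rw [ContinuousLinearMap.comp_apply, ContinuousLinearMap.id_apply] at h4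
    rw [h3, ContinuousLinearMap.comp_apply, h4]
  -- `Ω` is analytic, so only positive indices remain. For these, `Δ(t) Ω(-t) x = C̃(t) x` is
  -- analytic, and its inner products with `z fᵢ` are coanalytic. Generation puts it in `Δ H²`;
  -- cancelling `Δ` makes `Ω(-t) x` analytic too.
  have hcoeff : ∀ x, ∀ k, k ≠ 0 → fourierCoeff (fun t => Ω t x) k = 0 := by
    intro x k hk
    rcases lt_or_gt_of_ne hk with hk | hk
    · exact hΩ.1.2.2 x k hk
    have hΩx := memLp_comp_neg (hΩ.strongL2 x)
    have hLp := hΔ.memLp_apply hΩx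
    have hae : (hLp.toLp _ : UnitAddCircle → E) =ᵐ[haarAddCircle (T := (1 : ℝ))]
        fun t => tilde C t x := by
      filter_upwards [hLp.coeFn_toLp, hΔC] with t h1 h2
      rw [h1, h2]
    have hhardy : hLp.toLp _ ∈ hardy E := by
      intro j hj
      rw [fourierCoeff_congr hae]
      refine fourierCoeff_tilde ((integrable_coe (hLp.toLp _)).congr hae) fun y => ?_
      rw [← inner_fourierCoeff (hC.1.integrable y), hC.2 y j hj, inner_zero_right]
    have hmem : (⟨_, hhardy⟩ : hardy E) ∈ rangeH2 Δ := by
      refine hgen _ fun m i => ?_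
      rw [Submodule.coe_inner, inner_shift_pow]
      have h1 := fourierCoeff_inner_ofColumns_single (f := f)
        (hLp.toLp _ : UnitAddCircle → E) i ((m : ℤ) + 1)
      rw [add_sub_cancel_right] at h1
      rw [← h1]
      have h2 : (fun t => ⟪(hLp.toLp _ : UnitAddCircle → E) t,
          ofColumns (fun i => shift E (f i)) t (EuclideanSpace.single i 1)⟫_ℂ)
          =ᵐ[haarAddCircle (T := (1 : ℝ))]
          fun t => ⟪x, G (-t) (EuclideanSpace.single i 1)⟫_ℂ := by
        filter_upwards [hLp.coeFn_toLp, ae_comp_neg hfacA, ae_comp_neg hΩ.inner_map]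
          with t k1 k2 k3
        rw [k1, ← k3, ← ContinuousLinearMap.comp_apply (Ω (-t)) (G (-t)), ← k2, tilde, neg_neg,
          ContinuousLinearMap.adjoint_comp, ContinuousLinearMap.adjoint_adjoint,
          ContinuousLinearMap.comp_apply, ContinuousLinearMap.adjoint_inner_right]
      rw [fourierCoeff_congr_ae h2,
        fourierCoeff_comp_neg (fun t => ⟪x, G t (EuclideanSpace.single i 1)⟫_ℂ),
        ← inner_fourierCoeff (hG.1.integrable _), hG.2 _ _ (by omega), inner_zero_right]
    obtain ⟨h, hh⟩ := hmem
    have hΩh : ∀ᵐ t ∂(haarAddCircle (T := (1 : ℝ))),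
        Ω (-t) x = ((h : L2 E') : UnitAddCircle → E') t := by
      filter_upwards [hh, hLp.coeFn_toLp, hΔ.2] with t h1 h2 h3
      exact injective_of_adjoint_comp_self h3 (h2.symm.trans h1)
    have h1 := fourierCoeff_comp_neg (fun t => Ω t x) (-k)
    rw [neg_neg] at h1
    rw [← h1, fourierCoeff_congr_ae hΩh]
    exact h.2 _ (by omega)
  have hsep : TopologicalSpace.SeparableSpace E' :=
    have := FiniteDimensional.proper ℂ E'
    inferInstance
  have hconst : ∀ᵐ t ∂(haarAddCircle (T := (1 : ℝ))), ∀ i,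
      Ω t (Module.finBasis ℂ D' i) = fourierCoeff (fun t => Ω t (Module.finBasis ℂ D' i)) 0 :=
    ae_all_iff.2 fun i => ae_eq_const_of_fourierCoeff (hΩ.strongL2.integrable _) (hcoeff _)
  obtain ⟨t₀, h1, h2, h3⟩ := (hconst.and (hsurj.and hΩ.inner_map)).exists
  refine ⟨LinearIsometryEquiv.ofSurjective ⟨(Ω t₀).toLinearMap, norm_map_of_inner_map h3⟩ h2, ?_⟩
  filter_upwards [hconst] with t ht x
  have h4 : Ω t = Ω t₀ := ContinuousLinearMap.coe_injective
    ((Module.finBasis ℂ D').ext fun i => (ht i).trans (h1 i).symm)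
  rw [h4]
  rfl

/-- Any decomposition must have `A^* = Δ^* Φ` and `B = Φ - Δ Δ^* Φ`. The non-cyclicity bound holds
because the relevant complement lies in `Δ H²`, whose values at a point span at most `dim E'`
dimensions. -/
theorem exists_isCanonicalDecomposition (hΔ : IsInner Δ) (hf : ∀ i, f i ∈ modelSpace Δ)
    (hgen : ∀ g : hardy E, (∀ (m : ℕ) i, ⟪(shift E ^ m) g, f i⟫_ℂ = 0) → g ∈ rangeH2 Δ) :
    ∃ A B, IsCanonicalDecomposition (ofColumns fun i => shift E (f i)) Δ A B := by
  have hΦ := strongL2_ofColumns fun i => shift E (f i)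
  refine ⟨fun t => (ContinuousLinearMap.adjoint
      (ofColumns (fun i => shift E (f i)) t)).comp (Δ t),
    fun t => ofColumns (fun i => shift E (f i)) t - (Δ t).comp
      ((ContinuousLinearMap.adjoint (Δ t)).comp (ofColumns (fun i => shift E (f i)) t)),
    hΦ, ?_, hΔ, ?_, ?_, rightCoprime_of_generators hΔ hgen, ?_, ?_⟩
  · refine Eventually.of_forall fun t => ?_
    rw [ContinuousLinearMap.adjoint_comp, ContinuousLinearMap.adjoint_adjoint,
      add_sub_cancel]
  · have h1 : (tilde fun t => (ContinuousLinearMap.adjoint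
        (ofColumns (fun i => shift E (f i)) t)).comp (Δ t))
        = fun t => (tilde Δ t).comp (ofColumns (fun i => shift E (f i)) (-t)) := by
      funext t
      simp only [tilde, ContinuousLinearMap.adjoint_comp, ContinuousLinearMap.adjoint_adjoint]
    rw [h1]
    exact strongH2_adjoint_comp_ofColumns hΔ hf
  · intro x
    exact (hΦ x).sub (hΔ.memLp_apply (hΔ.memLp_adjoint_apply (hΦ x)))
  · filter_upwards [hΔ.2] with t ht
    rw [ContinuousLinearMap.comp_sub, ← ContinuousLinearMap.comp_assoc, ht,
      ContinuousLinearMap.id_comp, sub_self]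
  · intro ι b
    refine iSup₂_le fun ζ hζ => (edim_mono (Submodule.span_mono (Set.image_mono ?_))).trans
      (edim_span_evalDisk_rangeH2_le hΔ hζ)
    exact orthogonal_cyclicSpan_le_rangeH2 hgen b hΦ

theorem beurlingDegree_le (hΔ : IsInner Δ) (hn : n ≠ 0) (hf : ∀ i, f i ∈ modelSpace Δ)
    (hgen : ∀ g ∈ modelSpace Δ, (∀ (m : ℕ) i, ⟪g, (backwardShift E ^ m) (f i)⟫_ℂ = 0) → g = 0) :
    beurlingDegree Δ ≤ n := by
  have hgen' : ∀ g : hardy E, (∀ (m : ℕ) i, ⟪(shift E ^ m) g, f i⟫_ℂ = 0) → g ∈ rangeH2 Δ := by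
    intro g hg
    have : CompleteSpace (rangeH2 Δ) := (isClosed_rangeH2 hΔ).completeSpace_coe
    -- The part in `Δ H²` is invisible to the `fᵢ`, so the model-space part inherits all the
    -- orthogonality and vanishes by generation.
    obtain ⟨q, hq, p, hp, rfl⟩ := (rangeH2 Δ).exists_add_mem_mem_orthogonal g
    have hp0 : p = 0 := hgen p hp fun m i => by
      have h1 := hg m i
      rw [map_add, inner_add_left, hf i _
        (shift_pow_mem (fun g hg => shift_mem_rangeH2 Δ hg) hq m), zero_add] at h1
      rw [inner_backwardShift_pow, h1]
    rw [hp0, add_zero]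
    exact hq
  obtain ⟨A, B, h⟩ := exists_isCanonicalDecomposition hΔ hf hgen'
  have : Nonempty (Fin n) := ⟨⟨0, Nat.pos_of_ne_zero hn⟩⟩
  refine sInf_le ⟨EuclideanSpace ℂ (Fin n), inferInstance, inferInstance, inferInstance,
    inferInstance, inferInstance, _, A, B, h, ?_⟩
  rw [edim, ← Module.finrank_eq_rank, finrank_euclideanSpace_fin, Cardinal.toENat_nat]

/-- An infinite-dimensional generating subspace contributes `⊤`, so only finite families, namely
bases of generating subspaces, need testing. -/
theorem le_spectralMultiplicity {H : Type*} [NormedAddCommGroup H] [InnerProductSpace ℂ H]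
    {p : Submodule ℂ H} [CompleteSpace p] {T : H →L[ℂ] H} {S : p →L[ℂ] p}
    (hS : ∀ f, (S f : H) = T f) {c : ℕ∞}
    (hc : ∀ (n : ℕ) (v : Fin n → H), (∀ i, v i ∈ p) →
      (∀ g ∈ p, (∀ (m : ℕ) i, ⟪g, (T ^ m) (v i)⟫_ℂ = 0) → g = 0) → c ≤ n) :
    c ≤ spectralMultiplicity S := by
  refine le_iInf₂ fun F hF => ?_
  rcases lt_or_ge (Module.rank ℂ F) Cardinal.aleph0 with hfin | hinf
  · have : Module.Finite ℂ F := Module.rank_lt_aleph0_iff.1 hfin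
    have h1 : edim F = Module.finrank ℂ F := by
      rw [edim, ← Module.finrank_eq_rank, Cardinal.toENat_nat]
    rw [h1]
    let b := Module.finBasis ℂ F
    refine hc _ (fun i => ((b i : p) : H)) (fun i => (b i : p).2) fun g hg h => ?_
    refine congrArg Subtype.val ((closure_iSup_map_pow_eq_top_iff S F).1 hF ⟨g, hg⟩ fun m x hx => ?_)
    let L : F →ₗ[ℂ] ℂ := (innerₛₗ ℂ g) ∘ₗ ((T ^ m : H →L[ℂ] H) : H →ₗ[ℂ] H) ∘ₗ p.subtype ∘ₗ
      F.subtype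
    have hL : L = 0 := b.ext fun i => h m i
    have h2 := DFunLike.congr_fun hL ⟨x, hx⟩
    rw [Submodule.coe_inner, coe_pow_of_forall_coe hS, inner_eq_zero_symm]
    exact h2
  · rw [edim, Cardinal.toENat_eq_top.2 hinf]
    exact le_top

theorem one_le_edim (V : Type*) [AddCommGroup V] [Module ℂ V] [Nontrivial V] : 1 ≤ edim V := by
  have h : (1 : Cardinal) ≤ Module.rank ℂ V := Cardinal.one_le_iff_pos.2 rank_pos
  simpa [edim] using OrderHomClass.mono Cardinal.toENat h

end Construction

end Beurling

end

theorem theorem6 {E E' : Type*}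
    [NormedAddCommGroup E] [InnerProductSpace ℂ E] [CompleteSpace E]
    [TopologicalSpace.SeparableSpace E]
    [NormedAddCommGroup E'] [InnerProductSpace ℂ E'] [CompleteSpace E']
    [FiniteDimensional ℂ E']
    (Δ : UnitAddCircle → E' →L[ℂ] E) (hΔ : Beurling.IsInner Δ) :
    (Beurling.modelSpace Δ ≠ ⊥ →
      Beurling.spectralMultiplicity (Beurling.modelOperator Δ) = Beurling.beurlingDegree Δ) ∧
    (Beurling.modelSpace Δ = ⊥ → Beurling.beurlingDegree Δ = 1) := by
  refine ⟨fun hne => le_antisymm (le_sInf ?_) ?_, fun hbot => le_antisymm ?_ (le_sInf ?_)⟩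
  · rintro _ ⟨D, _, _, _, _, _, Φ, A, B, h, rfl⟩
    exact h.spectralMultiplicity_le
  · refine Beurling.le_spectralMultiplicity (Beurling.coe_modelOperator Δ) fun n v hv hgen => ?_
    -- The coefficient space must be nonzero; an empty generating family would force a zero model
    -- space.
    refine Beurling.beurlingDegree_le hΔ (fun hn => hne ?_) hv hgen
    subst hn
    exact (Submodule.eq_bot_iff _).2 fun g hg => hgen g hg fun _ i => i.elim0
  -- A single zero vector generates the zero space, so `Φ = 0` on a one-dimensional space attains
  -- the value 1.
  · refine (Beurling.beurlingDegree_le (n := 1) (f := fun _ => 0) hΔ one_ne_zero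
      (fun _ => Submodule.zero_mem _) fun g hg _ => ?_).trans_eq Nat.cast_one
    rwa [hbot, Submodule.mem_bot] at hg
  · rintro _ ⟨D, _, _, _, _, _, Φ, A, B, h, rfl⟩
    exact Beurling.one_le_edim D
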